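/- **Setting.** Let $G=(A\cup B,\mathcal E)$ be a finite $(d_A,d_B)$-biregular bipartite graph ($d_A,d_B\ge 1$; every vertex of $A$ has degree $d_A$, every vertex of $B$ has degree $d_B$), with $n_A=|A|$, $n_B=|B|$. For constants $\gamma_A,\delta_A,\gamma_B,\delta_B>0$, $G$ is *$(\gamma_A,\delta_A,\gamma_B,\delta_B)$-expanding* if $|\Gamma(S)|\ge(1-\delta_A)d_A|S|$ for all $S\subseteq A$ with $|S|\le\gamma_A n_A$, and $|\Gamma(S)|\ge(1-\delta_B)d_B|S|$ for all $S\subseteq B$ with $|S|\le\gamma_B n_B$. The associated *quantum expander code* is the CSS code with set of qubits $V=A^2\sqcup B^2$, so $n=n_A^2+n_B^2$ qubits, whose $Z$-type generators are indexed by $(\alpha,\beta)\in A\times B$, with support $\Gamma_X(\alpha,\beta)=\{(\alpha,a):a\in\Gamma(\beta)\}\cup\{(b,\beta):b\in\Gamma(\alpha)\}$, and whose $X$-type generators are indexed by $(b,a)\in B\times A$, with support $\Gamma_Z(b,a)=\{(\alpha,a):\alpha\in\Gamma(b)\}\cup\{(b,\beta):\beta\in\Gamma(a)\}$. **Decoder.**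 The syndrome $\sigma_X(E)$ of an $X$-type error $E\subseteq V$ is the set of $Z$-type generators whose support meets $E$ in an odd number of qubits. Let $\mathcal F$ be the set of nonempty $F\subseteq V$ contained in the support of some $X$-type generator. The small-set-flip decoder gets $\sigma=\sigma_X(E)$ and starts from $\hat E=\varnothing$. While some $F\in\mathcal F$ satisfies $|\sigma|-|\sigma\oplus\sigma_X(F)|>0$, it picks an $F\in\mathcal F$ maximizing $\big(|\sigma|-|\sigma\oplus\sigma_X(F)|\big)/|F|$ (arbitrarily, if there are several) and replaces $\hat E$ by $\hat E\oplus F$ and $\sigma$ by $\sigma\oplus\sigma_X(F)$; then it outputs $\hat E$. It *corrects* $E$ if, for all choices of maximizers, it halts and $E\oplus\hat E$ is a sum modulo $2$ of supports of $X$-type generators. $Z$-type errors are decoded in the same way with the roles of $X$ and $Z$ exchanged. **Noise.** A random set $E\subseteq V$ is *independent noise* of parameter $p$ if $\mathbb P(E=S)=p^{|S|}(1-p)^{|V|-|S|}$ for all $S\subseteq V$, and *local stochastic noise* of parameter $p$ if $\mathbb P(F\subseteq E)\le p^{|F|}$ for all $F\subseteq V$. **Theorem 1.** Let $d_A,d_B\ge1$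 be integers and let $\gamma_A,\delta_A,\gamma_B,\delta_B>0$ satisfy $\delta_A+\delta_B+(\delta_B-\delta_A)^2<\tfrac14$ (for instance $\delta_A,\delta_B<1/8$). Then there are $p_0\in(0,1]$ and $C,C'>0$, depending only on $d_A,d_B,\gamma_A,\delta_A,\gamma_B,\delta_B$, such that for every $(d_A,d_B)$-biregular $(\gamma_A,\delta_A,\gamma_B,\delta_B)$-expanding graph $G$ and every $0\le p<p_0$ the following holds for the associated quantum expander code on $n$ qubits. If $E$ is a random $X$-type error that is independent noise or local stochastic noise of parameter $p$, then the small-set-flip decoder corrects $E$ with probability at least $$1-C\,n\left(\frac{p}{p_0}\right)^{C'\sqrt n}.$$ Moreover, if $(E_X,E_Z)$ is a random pair of errors with an arbitrary joint distribution, each of $E_X$ and $E_Z$ being independent noise or local stochastic noise of parameter $p$, then with at least the same probability the decoder corrects both the $X$-type error $E_X$ and the $Z$-type error $E_Z$. -/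

import Mathlib

universe u v

namespace QExpander

open Finset

/-! ## Bipartite expander graphs

A bipartite graph with left vertices `A` and right vertices `B` is given by its edge relation
`G : A → B → Prop`. -/

section Graph

variable {A : Type u} {B : Type v} [Fintype A] [Fintype B] [DecidableEq A] [DecidableEq B]

/-- The neighbourhood in `B` of a left vertex. -/
def leftNbr (G : A → B → Prop) [DecidableRel G] (a : A) : Finset B := {b | G a b}

/-- The neighbourhood in `A` of a right vertex. -/
def rightNbr (G : A → B → Prop) [DecidableRel G] (b : B) : Finset A := {a | G a b}

/-- Every left vertex has degree `dA` and every right vertex has degree `dB`. -/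
def IsBiregular (G : A → B → Prop) [DecidableRel G] (dA dB : ℕ) : Prop :=
  (∀ a, #(leftNbr G a) = dA) ∧ (∀ b, #(rightNbr G b) = dB)

/-- `(γ, δ)`-left-expansion, for left degree `dA`. -/
def IsLeftExpanding (G : A → B → Prop) [DecidableRel G] (dA : ℕ) (γ δ : ℝ) : Prop :=
  ∀ S : Finset A, (#S : ℝ) ≤ γ * Fintype.card A →
    (1 - δ) * dA * #S ≤ #(S.biUnion (leftNbr G))

/-- `(γ, δ)`-right-expansion, for right degree `dB`. -/
def IsRightExpanding (G : A → B → Prop) [DecidableRel G] (dB : ℕ) (γ δ : ℝ) : Prop :=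
  ∀ S : Finset B, (#S : ℝ) ≤ γ * Fintype.card B →
    (1 - δ) * dB * #S ≤ #(S.biUnion (rightNbr G))

end Graph

/-! ## CSS codes and errors -/

/-- A CSS code with set of qubits `V`, given by its stabilizer generators: `suppX c` is the
support of the `Z`-type generator `c : CX` (a row of the parity-check matrix `H_X`), `suppZ g` is
the support of the `X`-type generator `g : CZ` (a row of `H_Z`), and `orth` is the condition
`H_X * H_Zᵀ = 0` over the field with two elements. -/
structure CSSCode (V : Type*) (CX : Type*) (CZ : Type*) [DecidableEq V] where
  suppX : CX → Finset V
  suppZ : CZ → Finset V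
  orth : ∀ c g, Even #(suppX c ∩ suppZ g)

namespace CSSCode

variable {V CX CZ : Type*} [DecidableEq V]

/-- The same code with the roles of `X` and `Z` exchanged. -/
def dual (Q : CSSCode V CX CZ) : CSSCode V CZ CX where
  suppX := Q.suppZ
  suppZ := Q.suppX
  orth c g := by rw [Finset.inter_comm]; exact Q.orth g c

variable [Fintype V] [Fintype CX] [DecidableEq CX]

/-- The syndrome `σ_X(E)` of a set `E` of qubits carrying an `X` error: the set of `Z`-type
generators whose support meets `E` in an odd number of qubits. -/
def syndrome (Q : CSSCode V CX CZ) (E : Finset V) : Finset CX := {c | Odd #(Q.suppX c ∩ E)}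

/-- The sum modulo two (iterated symmetric difference) of the supports of the `X`-type
generators in `T`. -/
def genSum (Q : CSSCode V CX CZ) (T : Finset CZ) : Finset V := {v | Odd #{g ∈ T | v ∈ Q.suppZ g}}

/-- Two `X`-type errors are equivalent when they differ by a sum of `X`-type generators. -/
def Equivalent (Q : CSSCode V CX CZ) (E E' : Finset V) : Prop :=
  ∃ T : Finset CZ, symmDiff E E' = Q.genSum T

/-! ## The small-set-flip decoder (for `X`-type errors) -/

/-- The family `𝓕` of small sets: nonempty subsets of the support of some `X`-type generator. -/
def IsSmallSet (Q : CSSCode V CX CZ) (F : Finset V) : Prop :=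
  F.Nonempty ∧ ∃ g, F ⊆ Q.suppZ g

/-- The decrease of the weight of the current syndrome `σ` when `F` is flipped. -/
def gain (Q : CSSCode V CX CZ) (σ : Finset CX) (F : Finset V) : ℤ :=
  (#σ : ℤ) - #(symmDiff σ (Q.syndrome F))

/-- The condition of the while loop: some small set decreases the weight of the syndrome. -/
def LoopCond (Q : CSSCode V CX CZ) (σ : Finset CX) : Prop :=
  ∃ F, Q.IsSmallSet F ∧ 0 < Q.gain σ F

/-- `F` maximizes the ratio (syndrome weight decrease) / (size) among all small sets. -/
def IsBestFlip (Q : CSSCode V CX CZ) (σ : Finset CX) (F : Finset V) : Prop :=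
  Q.IsSmallSet F ∧
    ∀ F', Q.IsSmallSet F' → (Q.gain σ F' : ℚ) / (#F' : ℚ) ≤ (Q.gain σ F : ℚ) / (#F : ℚ)

/-- One round of the loop, on states (current guess, current syndrome). A maximizer `F` is chosen
arbitrarily. -/
def Step (Q : CSSCode V CX CZ) (s s' : Finset V × Finset CX) : Prop :=
  Q.LoopCond s.2 ∧ ∃ F, Q.IsBestFlip s.2 F ∧
    s' = (symmDiff s.1 F, symmDiff s.2 (Q.syndrome F))

/-- Some execution of the decoder on the input `σ` halts with output `out`. -/
def Outputs (Q : CSSCode V CX CZ) (σ : Finset CX) (out : Finset V) : Prop :=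
  ∃ σ' : Finset CX, Relation.ReflTransGen Q.Step (∅, σ) (out, σ') ∧ ¬ Q.LoopCond σ'

/-- The decoder corrects the error `E`: on input `σ_X(E)` no execution is infinite, there is an
output, and whatever maximizers are chosen, the output is equivalent to `E`. -/
def Corrects (Q : CSSCode V CX CZ) (E : Finset V) : Prop :=
  Acc (fun s' s => Q.Step s s') (∅, Q.syndrome E) ∧
    (∃ out, Q.Outputs (Q.syndrome E) out) ∧
    ∀ out, Q.Outputs (Q.syndrome E) out → Q.Equivalent E out

end CSSCode

/-! ## Quantum expander codes: hypergraph product of the code of `G` with itself -/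

section Code

variable {A : Type u} {B : Type v} [Fintype A] [Fintype B] [DecidableEq A] [DecidableEq B]

/-- The qubits are indexed by the disjoint union of `A × A` and `B × B`. -/
abbrev Qubit (A : Type u) (B : Type v) : Type (max u v) := (A × A) ⊕ (B × B)

/-- The hypergraph product code: the `Z`-type generator `(α, β)` acts on the qubits `(α, a)` with
`a` a neighbour of `β` and `(b, β)` with `b` a neighbour of `α`; the `X`-type generator `(b, a)`
acts on the qubits `(α, a)` with `α` a neighbour of `b` and `(b, β)` with `β` a neighbour
of `a`. -/
def expanderCode (G : A → B → Prop) [DecidableRel G] :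
    CSSCode (Qubit A B) (A × B) (B × A) where
  suppX c := ({c.1} ×ˢ rightNbr G c.2).disjSum (leftNbr G c.1 ×ˢ {c.2})
  suppZ g := (rightNbr G g.1 ×ˢ {g.2}).disjSum ({g.1} ×ˢ leftNbr G g.2)
  orth := by
    rintro ⟨α, β⟩ ⟨b, a⟩
    by_cases h : G α b ∧ G a β
    · have : (({α} ×ˢ rightNbr G β).disjSum (leftNbr G α ×ˢ {β}) : Finset (Qubit A B)) ∩
          (rightNbr G b ×ˢ {a}).disjSum ({b} ×ˢ leftNbr G a) =
          {Sum.inl (α, a), Sum.inr (b, β)} := by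
        ext x
        rcases x with ⟨x, y⟩ | ⟨x, y⟩ <;> simp [leftNbr, rightNbr] <;> grind
      simp only
      rw [this]
      simp
    · have : (({α} ×ˢ rightNbr G β).disjSum (leftNbr G α ×ˢ {β}) : Finset (Qubit A B)) ∩
          (rightNbr G b ×ˢ {a}).disjSum ({b} ×ˢ leftNbr G a) = ∅ := by
        ext x
        rcases x with ⟨x, y⟩ | ⟨x, y⟩ <;> simp [leftNbr, rightNbr] <;> grind
      simp only
      rw [this]
      simp

end Code

/-! ## Noise models -/

section Noise

/-- The probability of the event `s` under the distribution `D`. -/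
noncomputable def prob {α : Type*} (D : PMF α) (s : Set α) : ℝ := (D.toOuterMeasure s).toReal

variable {V : Type*} [Fintype V]

/-- Independent noise of parameter `p` on a set `V` of qubits. -/
def IsIndependentNoise (D : PMF (Finset V)) (p : ℝ) : Prop :=
  ∀ E : Finset V, prob D {E} = p ^ #E * (1 - p) ^ (Fintype.card V - #E)

/-- Local stochastic noise of parameter `p` on a set `V` of qubits. -/
def IsLocalStochasticNoise (D : PMF (Finset V)) (p : ℝ) : Prop :=
  ∀ F : Finset V, prob D {E | F ⊆ E} ≤ p ^ #F

end Noise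

end QExpander

open QExpander

/-!
The decoder is controlled by two facts, and neither uses that it picks the best flip: any rule that
only makes flips decreasing the weight of the syndrome would do.

*Small errors can be flipped away* (`hasFlips_expanderCode`). Let `E` be a nonempty error with at
most `c √n` qubits that no single generator shrinks. Expansion gives a generator `(b, a)` such that,
apart from fractions `2 δB` and `2 δA` of the two halves of its support, the checks between the
halves meet `E` only in that support, and `E` meets the remaining part (`exists_critical`). The
reason is that a small set in an expander has a point with few shared neighbours
(`exists_few_shared`). Flipping the
qubits of the remaining part of the support that lie in `E`, or those that do not, decreases the
weight of the syndrome by at least `dA dB (x + y - 2 x y - 4 δA x - 4 δB y)`, where `x`, `y` are the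
fractions of the two halves that are flipped. One of the two choices has `x + y ≤ 1`; it is not
empty, since `E` is not shrunk by the generator; and for such `x`, `y` the bound is positive exactly
by the hypothesis on `δA` and `δB` (`gain_pos_aux`). An error that is not a sum of generators can be
reduced without changing its syndrome, so the decoder does not stop there.

*The decoder is local* (`exists_grown_of_not_corrects`). Call two qubits adjacent when they share a
generator, and let `U` be the union of the error and of all flips made. Different components of `U`
have disjoint syndromes and each flip lies in one component, so each component `K` is paid for by the
syndrome of the error in it: `#K ≤ M * #(E ∩ K)` for a constant `M`. If all components have at most
`c √n` qubits, the residual error in each must be a sum of generators by the first fact. So a failure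
produces a connected set of more than `c √n` qubits of which `E` fills a fraction `1 / M`.

Finally, a graph of degree at most `d` has at most `n d ^ (2 s)` connected sets of size `s + 1`
(`card_grown_le`), so below the threshold `p₀ = (1 / (4 d ^ 2)) ^ M` a union bound over these sets
and over the positions of the errors in them gives a geometric series (`prob_grown_le`). The other
type of errors is treated by exchanging the two sides of the graph, and a union bound handles the two
types together without any assumption on the joint distribution.
-/

namespace QExpander

open Finset

/-! ### Parities, syndromes and sums of generators -/

lemma card_symmDiff_add {α : Type*} [DecidableEq α] (X Y : Finset α) :
    #(symmDiff X Y) + 2 * #(X ∩ Y) = #X + #Y := by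
  have h : #(symmDiff X Y) = #(X \ Y) + #(Y \ X) := by
    rw [symmDiff_def, sup_eq_union, card_union_of_disjoint disjoint_sdiff_sdiff]
  have h₁ := card_sdiff_add_card_inter X Y
  have h₂ := card_sdiff_add_card_inter Y X
  rw [inter_comm Y X] at h₂
  omega

lemma odd_card_symmDiff {α : Type*} [DecidableEq α] (X Y : Finset α) :
    Odd #(symmDiff X Y) ↔ Xor (Odd #X) (Odd #Y) := by
  have h := card_symmDiff_add X Y
  simp only [Nat.odd_iff, xor_def]
  omega

namespace CSSCode

variable {V CX CZ : Type*} [DecidableEq V] (Q : CSSCode V CX CZ)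

lemma genSum_empty [Fintype V] : Q.genSum ∅ = ∅ := by
  simp [genSum]

lemma genSum_symmDiff [Fintype V] [DecidableEq CZ] (T T' : Finset CZ) :
    Q.genSum (symmDiff T T') = symmDiff (Q.genSum T) (Q.genSum T') := by
  ext v
  have h : ({g ∈ symmDiff T T' | v ∈ Q.suppZ g} : Finset CZ) =
      symmDiff {g ∈ T | v ∈ Q.suppZ g} {g ∈ T' | v ∈ Q.suppZ g} := by
    ext g
    simp only [mem_filter, mem_symmDiff]
    tauto
  simp only [genSum, mem_filter, mem_univ, true_and, h, odd_card_symmDiff, mem_symmDiff, xor_def]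

lemma genSum_singleton [Fintype V] (g : CZ) : Q.genSum {g} = Q.suppZ g := by
  ext v
  by_cases h : v ∈ Q.suppZ g <;> simp [genSum, filter_singleton, h]

lemma mem_syndrome [Fintype CX] {E : Finset V} {c : CX} :
    c ∈ Q.syndrome E ↔ Odd #(Q.suppX c ∩ E) := by
  simp [syndrome]

lemma syndrome_empty [Fintype CX] : Q.syndrome ∅ = ∅ := by
  simp [syndrome]

lemma syndrome_suppZ [Fintype CX] (g : CZ) : Q.syndrome (Q.suppZ g) = ∅ := by
  ext c
  simp [mem_syndrome, Q.orth c g]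

variable [Fintype CX] [DecidableEq CX]

lemma syndrome_symmDiff (E E' : Finset V) :
    Q.syndrome (symmDiff E E') = symmDiff (Q.syndrome E) (Q.syndrome E') := by
  ext c
  have h : Q.suppX c ∩ symmDiff E E' = symmDiff (Q.suppX c ∩ E) (Q.suppX c ∩ E') :=
    inf_symmDiff_distrib_left _ _ _
  simp only [mem_symmDiff, mem_syndrome, h, odd_card_symmDiff, xor_def]

lemma syndrome_genSum [Fintype V] (T : Finset CZ) : Q.syndrome (Q.genSum T) = ∅ := by
  classical
  induction T using Finset.induction_on with
  | empty => rw [genSum_empty, syndrome_empty]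
  | insert g T hg ih =>
    have h : insert g T = symmDiff {g} T := by
      ext x
      simp only [mem_insert, mem_symmDiff, mem_singleton]
      constructor
      · rintro (rfl | hx)
        · exact Or.inl ⟨rfl, hg⟩
        · exact Or.inr ⟨hx, fun h => hg (h ▸ hx)⟩
      · tauto
    rw [h, genSum_symmDiff, syndrome_symmDiff, ih, genSum_singleton, syndrome_suppZ]
    simp

lemma gain_eq (σ : Finset CX) (F : Finset V) :
    Q.gain σ F = 2 * #(σ ∩ Q.syndrome F) - #(Q.syndrome F) := by
  have h := card_symmDiff_add σ (Q.syndrome F)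
  unfold gain
  omega

/-! ### Termination of the decoder -/

lemma card_lt_of_step {s s' : Finset V × Finset CX} (h : Q.Step s s') : #s'.2 < #s.2 := by
  obtain ⟨⟨F₀, hF₀, hgain⟩, F, ⟨hF, hmax⟩, rfl⟩ := h
  have h₀ : (0 : ℚ) < Q.gain s.2 F / #F :=
    (div_pos (by exact_mod_cast hgain) (by exact_mod_cast hF₀.1.card_pos)).trans_le (hmax F₀ hF₀)
  have h₁ : (0 : ℚ) < Q.gain s.2 F := by
    by_contra hneg
    exact absurd (div_nonpos_of_nonpos_of_nonneg (not_lt.1 hneg) (Nat.cast_nonneg _))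
      (not_le.2 h₀)
  have h₂ : 0 < Q.gain s.2 F := by exact_mod_cast h₁
  unfold gain at h₂
  simp only
  omega

lemma acc_step (s : Finset V × Finset CX) : Acc (fun s' s => Q.Step s s') s :=
  Subrelation.accessible (fun h => Q.card_lt_of_step h)
    ((measure fun s : Finset V × Finset CX => #s.2).wf.apply s)

lemma exists_step [Fintype V] {s : Finset V × Finset CX} (h : Q.LoopCond s.2) :
    ∃ s', Q.Step s s' := by
  classical
  obtain ⟨F₀, hF₀, -⟩ := id h
  obtain ⟨F, hF, hmax⟩ := Finset.exists_max_image ({F | Q.IsSmallSet F} : Finset (Finset V))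
    (fun F => (Q.gain s.2 F : ℚ) / (#F : ℚ)) ⟨F₀, by simpa using hF₀⟩
  simp only [mem_filter, mem_univ, true_and] at hF hmax
  exact ⟨_, h, F, ⟨hF, hmax⟩, rfl⟩

lemma exists_halting [Fintype V] (s : Finset V × Finset CX) :
    ∃ s', Relation.ReflTransGen Q.Step s s' ∧ ¬ Q.LoopCond s'.2 := by
  induction Q.acc_step s with
  | intro s _ ih =>
    by_cases h : Q.LoopCond s.2
    · obtain ⟨s₁, hs₁⟩ := Q.exists_step h
      obtain ⟨s', hs', hhalt⟩ := ih s₁ hs₁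
      exact ⟨s', hs'.head hs₁, hhalt⟩
    · exact ⟨s, .refl, h⟩

lemma corrects_iff [Fintype V] (E : Finset V) :
    Q.Corrects E ↔ ∀ out, Q.Outputs (Q.syndrome E) out → Q.Equivalent E out := by
  refine ⟨fun h => h.2.2, fun h => ⟨Q.acc_step _, ?_, h⟩⟩
  obtain ⟨⟨out, σ'⟩, h₁, h₂⟩ := Q.exists_halting (∅, Q.syndrome E)
  exact ⟨out, σ', h₁, h₂⟩

end CSSCode

/-! ### Connected sets -/

/-- The finite sets that are connected for the relation `r` and contain `v`: those obtained from
`{v}` by adding, one at a time, a point related to a point that is already there. -/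
inductive Grown {V : Type*} [DecidableEq V] (r : V → V → Prop) (v : V) : Finset V → Prop
  | single : Grown r v {v}
  | insert {K : Finset V} {u w : V} :
      Grown r v K → u ∈ K → r u w → w ∉ K → Grown r v (insert w K)

lemma Grown.mem {V : Type*} [DecidableEq V] {r : V → V → Prop} {v : V} {K : Finset V}
    (h : Grown r v K) : v ∈ K := by
  induction h with
  | single => exact mem_singleton_self v
  | insert _ _ _ _ ih => exact mem_insert_of_mem ih

/-- The connected component of `v` in `U`. -/
lemma exists_grown_closed {V : Type*} [DecidableEq V] (r : V → V → Prop) {U : Finset V} {v : V}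
    (hv : v ∈ U) :
    ∃ K ⊆ U, Grown r v K ∧ ∀ u ∈ K, ∀ w ∈ U, r u w → w ∈ K := by
  classical
  obtain ⟨K, hK, hmax⟩ := Finset.exists_max_image {K ∈ U.powerset | Grown r v K} card
    ⟨{v}, by simpa using ⟨hv, Grown.single⟩⟩
  simp only [mem_filter, mem_powerset] at hK hmax
  refine ⟨K, hK.1, hK.2, fun u hu w hw huw => ?_⟩
  by_contra hwK
  have := hmax (insert w K) ⟨insert_subset hw hK.1, hK.2.insert hu huw hwK⟩
  rw [card_insert_of_notMem hwK] at this
  omega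

namespace CSSCode

variable {V CX CZ : Type*} [DecidableEq V] (Q : CSSCode V CX CZ)

/-! ### Locality of the decoder -/

/-- Two qubits are adjacent when some generator, of either type, acts on both. With the generators
of both types, distinct components share no check and every small set is a clique. -/
def Adj (u v : V) : Prop :=
  (∃ c, u ∈ Q.suppX c ∧ v ∈ Q.suppX c) ∨ ∃ g, u ∈ Q.suppZ g ∧ v ∈ Q.suppZ g

lemma Adj.symm {u v : V} (h : Q.Adj u v) : Q.Adj v u := by
  rcases h with ⟨c, h₁, h₂⟩ | ⟨g, h₁, h₂⟩
  · exact Or.inl ⟨c, h₂, h₁⟩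
  · exact Or.inr ⟨g, h₂, h₁⟩

/-- `W` cuts `U` into two pieces with no adjacency between them. -/
def Separates (U W : Finset V) : Prop :=
  ∀ u ∈ U ∩ W, ∀ v ∈ U \ W, ¬ Q.Adj u v

/-- The parity-check matrices of the code have row and column weights at most `w`. -/
structure IsBounded [Fintype CX] [Fintype CZ] (w : ℕ) : Prop where
  card_suppX_le : ∀ c, #(Q.suppX c) ≤ w
  card_suppZ_le : ∀ g, #(Q.suppZ g) ≤ w
  degX_le : ∀ v, #{c | v ∈ Q.suppX c} ≤ w
  degZ_le : ∀ v, #{g | v ∈ Q.suppZ g} ≤ w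

/-- A nonempty error of size at most `t` that no single generator can shrink admits a
small set whose flip decreases the weight of the syndrome. -/
def HasFlips [Fintype CX] [DecidableEq CX] (t : ℝ) : Prop :=
  ∀ E : Finset V, E.Nonempty → (#E : ℝ) ≤ t →
    (∀ g, #E ≤ #(symmDiff E (Q.suppZ g))) →
    ∃ F, Q.IsSmallSet F ∧ 0 < Q.gain (Q.syndrome E) F

variable {Q} [Fintype CX]

lemma exists_mem_of_mem_syndrome {E : Finset V} {c : CX} (h : c ∈ Q.syndrome E) :
    ∃ v ∈ E, v ∈ Q.suppX c := by
  obtain ⟨v, hv⟩ := card_pos.1 (Q.mem_syndrome.1 h).pos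
  exact ⟨v, mem_of_mem_inter_right hv, mem_of_mem_inter_left hv⟩

lemma card_syndrome_le [Fintype CZ] [DecidableEq CX] {w : ℕ} (hw : Q.IsBounded w) (E : Finset V) :
    #(Q.syndrome E) ≤ w * #E := by
  have hsub : Q.syndrome E ⊆ E.biUnion fun v => ({c | v ∈ Q.suppX c} : Finset CX) := by
    intro c hc
    obtain ⟨v, hv, hvc⟩ := exists_mem_of_mem_syndrome hc
    exact mem_biUnion.2 ⟨v, hv, by simpa using hvc⟩
  calc #(Q.syndrome E) ≤ _ := card_le_card hsub
    _ ≤ #E * w := card_biUnion_le_card_mul _ _ _ fun v _ => hw.degX_le v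
    _ = w * #E := mul_comm _ _

lemma Separates.disjoint_syndrome {U W X Y : Finset V} (h : Q.Separates U W)
    (hX : X ⊆ U ∩ W) (hY : Y ⊆ U \ W) : Disjoint (Q.syndrome X) (Q.syndrome Y) := by
  refine disjoint_left.2 fun c hcX hcY => ?_
  obtain ⟨x, hx, hxc⟩ := exists_mem_of_mem_syndrome hcX
  obtain ⟨y, hy, hyc⟩ := exists_mem_of_mem_syndrome hcY
  exact h x (hX hx) y (hY hy) (Or.inl ⟨c, hxc, hyc⟩)

variable [DecidableEq CX]

lemma symmDiff_inter_sdiff {α : Type*} [DecidableEq α] (R W : Finset α) :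
    symmDiff (R ∩ W) (R \ W) = R := by
  ext x
  simp only [mem_symmDiff, mem_inter, mem_sdiff]
  tauto

lemma syndrome_split (R W : Finset V) :
    Q.syndrome R = symmDiff (Q.syndrome (R ∩ W)) (Q.syndrome (R \ W)) := by
  rw [← syndrome_symmDiff, symmDiff_inter_sdiff]

lemma Separates.gain_le {U W R : Finset V} (h : Q.Separates U W) (hR : R ⊆ U) (F : Finset V) :
    Q.gain (Q.syndrome (R ∩ W)) F ≤ Q.gain (Q.syndrome R) F := by
  have hd : Disjoint (Q.syndrome (R ∩ W)) (Q.syndrome (R \ W)) :=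
    h.disjoint_syndrome (inter_subset_inter_right hR) (sdiff_subset_sdiff hR subset_rfl)
  have hsub : Q.syndrome (R ∩ W) ∩ Q.syndrome F ⊆ Q.syndrome R ∩ Q.syndrome F := by
    refine inter_subset_inter_right ?_
    rw [syndrome_split R W, hd.symmDiff_eq_sup]
    exact subset_union_left
  have := card_le_card hsub
  rw [gain_eq, gain_eq]
  omega

lemma Separates.gain_eq_of_subset {U W R F : Finset V} (h : Q.Separates U W) (hR : R ⊆ U)
    (hF : F ⊆ U ∩ W) : Q.gain (Q.syndrome (R ∩ W)) F = Q.gain (Q.syndrome R) F := by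
  have hd : Disjoint (Q.syndrome F) (Q.syndrome (R \ W)) :=
    h.disjoint_syndrome hF (sdiff_subset_sdiff hR subset_rfl)
  have heq : Q.syndrome (R ∩ W) ∩ Q.syndrome F = Q.syndrome R ∩ Q.syndrome F := by
    rw [syndrome_split R W]
    ext c
    have : c ∈ Q.syndrome F → c ∉ Q.syndrome (R \ W) := fun h => disjoint_left.1 hd h
    simp only [mem_inter, mem_symmDiff]
    tauto
  rw [gain_eq, gain_eq, heq]

/-- Each flip decreases the syndrome of the component it lies in, so the flips made in a union of
components are paid for by the syndrome that the error has there. Here `U` collects the error and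
all the qubits that have been flipped. -/
lemma exists_support_of_reachable [Fintype CZ] {w : ℕ} (hw : Q.IsBounded w) (E : Finset V)
    {s : Finset V × Finset CX} (h : Relation.ReflTransGen Q.Step (∅, Q.syndrome E) s) :
    s.2 = Q.syndrome (symmDiff E s.1) ∧
      ∃ U : Finset V, E ⊆ U ∧ symmDiff E s.1 ⊆ U ∧ ∀ W, Q.Separates U W →
        #(U ∩ W) + w * #(Q.syndrome (symmDiff E s.1 ∩ W)) ≤ (1 + w * w) * #(E ∩ W) := by
  induction h with
  | refl =>
    have hE : symmDiff E ∅ = E := symmDiff_bot E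
    simp only [hE, true_and]
    refine ⟨E, subset_rfl, subset_rfl, fun W _ => ?_⟩
    have := Nat.mul_le_mul_left w (card_syndrome_le hw (E ∩ W))
    linarith
  | @tail s s' _ hstep ih =>
    obtain ⟨hσ, U, hEU, hRU, hU⟩ := ih
    have hlt := Q.card_lt_of_step hstep
    obtain ⟨-, F, ⟨⟨hFne, g, hFg⟩, -⟩, rfl⟩ := hstep
    simp only at hlt ⊢
    set R := symmDiff E s.1 with hR
    have hR' : symmDiff E (symmDiff s.1 F) = symmDiff R F := (symmDiff_assoc _ _ _).symm
    rw [hR']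
    refine ⟨by rw [hσ, syndrome_symmDiff Q R], U ∪ F, hEU.trans subset_union_left, ?_, ?_⟩
    · intro x hx
      have := @hRU x
      simp only [mem_symmDiff, mem_union] at hx ⊢
      tauto
    · intro W hW
      have hWU : Q.Separates U W := fun u hu v hv => by
        refine hW u ?_ v ?_ <;> simp only [mem_inter, mem_sdiff, mem_union] at * <;> tauto
      have hUW := hU W hWU
      have hgain : 0 < Q.gain (Q.syndrome R) F := by
        unfold gain
        rw [← hσ]
        omega
      -- A small set is a clique, hence lies on one side of the cut.
      have hside : F ⊆ W ∨ Disjoint F W := by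
        by_contra! hcon
        obtain ⟨y, hy, hyW⟩ := not_subset.1 hcon.1
        obtain ⟨x, hx, hxW⟩ := not_disjoint_iff.1 hcon.2
        exact hW x (by simp [hx, hxW]) y (by simp [hy, hyW]) (Or.inr ⟨g, hFg hx, hFg hy⟩)
      rcases hside with hFW | hFW
      · have hF : F ⊆ (U ∪ F) ∩ W := subset_inter subset_union_right hFW
        have hg := hW.gain_eq_of_subset (hRU.trans subset_union_left) hF
        have hinter : symmDiff R F ∩ W = symmDiff (R ∩ W) F := by
          ext x
          have := @hFW x
          simp only [mem_inter, mem_symmDiff]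
          tauto
        rw [hinter, syndrome_symmDiff]
        have hlt' : #(symmDiff (Q.syndrome (R ∩ W)) (Q.syndrome F)) + 1 ≤
            #(Q.syndrome (R ∩ W)) := by
          rw [← hg] at hgain
          unfold gain at hgain
          omega
        have hcard : #((U ∪ F) ∩ W) ≤ #(U ∩ W) + w := by
          have hsub : (U ∪ F) ∩ W ⊆ (U ∩ W) ∪ F := by
            intro x
            simp only [mem_inter, mem_union]
            tauto
          calc _ ≤ _ := card_le_card hsub
            _ ≤ _ := card_union_le _ _
            _ ≤ _ := by gcongr; exact (card_le_card hFg).trans (hw.card_suppZ_le g)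
        have := Nat.mul_le_mul_left w hlt'
        linarith
      · have h₁ : (U ∪ F) ∩ W = U ∩ W := by
          ext x
          have : x ∈ F → x ∉ W := fun h => disjoint_left.1 hFW h
          simp only [mem_inter, mem_union]
          tauto
        have h₂ : symmDiff R F ∩ W = R ∩ W := by
          ext x
          have : x ∈ F → x ∉ W := fun h => disjoint_left.1 hFW h
          simp only [mem_inter, mem_symmDiff]
          tauto
        rw [h₁, h₂]
        exact hUW

variable [Fintype V] [Fintype CZ]

/-- An error of size at most `t` that is not a sum of generators can be reduced without changing its
syndrome, hence admits a useful flip. -/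
lemma HasFlips.exists_flip {t : ℝ} (ht : Q.HasFlips t) {R : Finset V} (hR : (#R : ℝ) ≤ t)
    (hne : ∀ T, R ≠ Q.genSum T) : ∃ F, Q.IsSmallSet F ∧ 0 < Q.gain (Q.syndrome R) F := by
  classical
  obtain ⟨T, -, hT⟩ := Finset.exists_min_image (univ : Finset (Finset CZ))
    (fun T => #(symmDiff R (Q.genSum T))) univ_nonempty
  have hsyn : Q.syndrome (symmDiff R (Q.genSum T)) = Q.syndrome R := by
    rw [syndrome_symmDiff, syndrome_genSum]
    exact symmDiff_bot _
  rw [← hsyn]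
  refine ht _ ?_ ?_ ?_
  · rw [nonempty_iff_ne_empty]
    exact fun h => hne T (symmDiff_eq_bot.1 h)
  · have := hT ∅ (mem_univ _)
    rw [genSum_empty, show symmDiff R ∅ = R from symmDiff_bot R] at this
    exact le_trans (by exact_mod_cast this) hR
  · intro g
    rw [symmDiff_assoc, ← genSum_singleton, ← genSum_symmDiff]
    exact hT _ (mem_univ _)

/-- If the decoder fails on `E`, some connected set of size more than `t` meets `E` in
a positive fraction of its points. -/
lemma exists_grown_of_not_corrects {w : ℕ} {t : ℝ} (hw : Q.IsBounded w) (ht : Q.HasFlips t)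
    {E : Finset V} (hE : ¬ Q.Corrects E) :
    ∃ v K, Grown Q.Adj v K ∧ t < #K ∧ #K ≤ (1 + w * w) * #(E ∩ K) := by
  classical
  by_contra! hcon
  refine hE ((Q.corrects_iff E).2 ?_)
  rintro out ⟨σ, hreach, hhalt⟩
  obtain ⟨hσ, U, hEU, hRU, hU⟩ := exists_support_of_reachable hw E hreach
  simp only at hσ hU hRU
  rw [hσ] at hhalt
  unfold Equivalent
  set R := symmDiff E out with hR
  -- The residual error is a sum of generators on each union of components of `U`.
  have key : ∀ n, ∀ W ⊆ U, #W = n → Q.Separates U W → ∃ T, R ∩ W = Q.genSum T := by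
    intro n
    induction n using Nat.strong_induction_on with
    | _ n ih =>
    rintro W hWU rfl hW
    rcases W.eq_empty_or_nonempty with rfl | ⟨v, hv⟩
    · exact ⟨∅, by rw [genSum_empty, inter_empty]⟩
    obtain ⟨K, hKW, hK, hclosed⟩ := exists_grown_closed Q.Adj hv
    have hKsep : Q.Separates U K := by
      intro x hx y hy hadj
      rw [mem_inter] at hx
      rw [mem_sdiff] at hy
      by_cases hyW : y ∈ W
      · exact hy.2 (hclosed x hx.2 y hyW hadj)
      · exact hW x (by simp [hx.1, hKW hx.2]) y (by simp [hy.1, hyW]) hadj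
    have hsep : Q.Separates U (W \ K) := by
      intro x hx y hy hadj
      simp only [mem_inter, mem_sdiff] at hx hy
      by_cases hyW : y ∈ W
      · have hyK : y ∈ K := by tauto
        exact hx.2.2 (hclosed y hyK x hx.2.1 hadj.symm)
      · exact hW x (by simp [hx.1, hx.2.1]) y (by simp [hy.1, hyW]) hadj
    have hlt : #(W \ K) < #W :=
      card_lt_card ⟨sdiff_subset, fun h => (mem_sdiff.1 (h hv)).2 hK.mem⟩
    obtain ⟨T₁, hT₁⟩ := ih _ hlt (W \ K) (sdiff_subset.trans hWU) rfl hsep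
    have hKle : #K ≤ (1 + w * w) * #(E ∩ K) := by
      have := hU K hKsep
      rw [inter_eq_right.2 (hKW.trans hWU)] at this
      omega
    have hKt : (#K : ℝ) ≤ t := by
      by_contra! h
      exact absurd hKle (not_le.2 (hcon v K hK h))
    have hT₂ : ∃ T, R ∩ K = Q.genSum T := by
      by_contra! hno
      have hcard : (#(R ∩ K) : ℝ) ≤ t :=
        le_trans (by exact_mod_cast card_le_card inter_subset_right) hKt
      obtain ⟨F, hF, hgain⟩ := ht.exists_flip hcard hno
      exact hhalt ⟨F, hF, hgain.trans_le (hKsep.gain_le hRU F)⟩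
    obtain ⟨T₂, hT₂⟩ := hT₂
    refine ⟨symmDiff T₁ T₂, ?_⟩
    rw [genSum_symmDiff, ← hT₁, ← hT₂]
    ext x
    have := @hKW x
    simp only [mem_inter, mem_symmDiff, mem_sdiff]
    tauto
  have hsep : Q.Separates U U := fun u _ v hv => by simp at hv
  obtain ⟨T, hT⟩ := key _ U subset_rfl rfl hsep
  exact ⟨T, by rw [← hT, inter_eq_left.2 hRU]⟩

end CSSCode

/-! ### Counting connected sets -/

section Counting

variable {V : Type*} [DecidableEq V]

/-- The lists of `m` further vertices visited by the walks that start at `v`, where `N` gives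
the neighbours of each vertex. -/
def walks (N : V → Finset V) : ℕ → V → Finset (List V)
  | 0, _ => {[]}
  | m + 1, v => (N v).biUnion fun w => (walks N m w).image (List.cons w)

lemma card_walks_le {N : V → Finset V} {D : ℕ} (hN : ∀ v, #(N v) ≤ D) (m : ℕ) (v : V) :
    #(walks N m v) ≤ D ^ m := by
  induction m generalizing v with
  | zero => simp [walks]
  | succ m ih =>
    calc #(walks N (m + 1) v) ≤ #(N v) * D ^ m :=
          card_biUnion_le_card_mul _ _ _ fun w _ => card_image_le.trans (ih w)
      _ ≤ D * D ^ m := Nat.mul_le_mul_right _ (hN v)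
      _ = D ^ (m + 1) := by ring

lemma mem_walks {r : V → V → Prop} {N : V → Finset V} (hN : ∀ u w, r u w → w ∈ N u)
    (l : List V) (v : V) (h : (v :: l).IsChain r) : l ∈ walks N l.length v := by
  induction l generalizing v with
  | nil => simp [walks]
  | cons w l ih =>
    rw [List.isChain_cons_cons] at h
    exact mem_biUnion.2 ⟨w, hN _ _ h.1, mem_image.2 ⟨l, ih w h.2, rfl⟩⟩

/-- A connected set with `s` points is covered by a walk with `2 * (s - 1)` steps: a new point is
reached by inserting an excursion from an old one. -/
lemma Grown.exists_walk {r : V → V → Prop} (hr : ∀ u w, r u w → r w u) {v : V} {K : Finset V}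
    (h : Grown r v K) :
    ∃ l : List V, (v :: l).IsChain r ∧ l.length + 2 = 2 * #K ∧ (v :: l).toFinset = K := by
  induction h with
  | single => exact ⟨[], by simp⟩
  | @insert K u w _ hu huw hw ih =>
    obtain ⟨l, hl, hlen, hK⟩ := ih
    have hul : u ∈ v :: l := by rwa [← List.mem_toFinset, hK]
    obtain ⟨l₁, l₂, hsplit⟩ := List.append_of_mem hul
    have hhead : ∃ l', l₁ ++ u :: w :: u :: l₂ = v :: l' := by
      rcases l₁ with _ | ⟨x, l₁⟩
      · simp only [List.nil_append, List.cons.injEq] at hsplit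
        exact ⟨_, by rw [hsplit.1]; rfl⟩
      · simp only [List.cons_append, List.cons.injEq] at hsplit
        exact ⟨_, by rw [hsplit.1]; rfl⟩
    obtain ⟨l', hl'⟩ := hhead
    refine ⟨l', ?_, ?_, ?_⟩
    · rw [← hl']
      rw [hsplit, List.isChain_split] at hl
      rw [List.isChain_split]
      exact ⟨hl.1, by
        rw [List.isChain_cons_cons, List.isChain_cons_cons]
        exact ⟨huw, hr _ _ huw, hl.2⟩⟩
    · have h₁ := congrArg List.length hl'
      have h₂ := congrArg List.length hsplit
      simp only [List.length_append, List.length_cons] at h₁ h₂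
      rw [card_insert_of_notMem hw]
      omega
    · rw [← hl', ← hK, hsplit]
      ext x
      simp only [List.mem_toFinset, List.mem_append, List.mem_cons, mem_insert]
      tauto

open Classical in
lemma card_grown_le [Fintype V] {r : V → V → Prop} (hr : ∀ u w, r u w → r w u)
    {N : V → Finset V} (hN : ∀ u w, r u w → w ∈ N u) {D : ℕ} (hD : ∀ v, #(N v) ≤ D)
    (v : V) (s : ℕ) :
    #({K | Grown r v K ∧ #K = s + 1} : Finset (Finset V)) ≤ D ^ (2 * s) := by
  have hsub : ({K | Grown r v K ∧ #K = s + 1} : Finset (Finset V)) ⊆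
      (walks N (2 * s) v).image fun l => (v :: l).toFinset := by
    intro K hK
    simp only [mem_filter, mem_univ, true_and] at hK
    obtain ⟨l, hl, hlen, hlK⟩ := hK.1.exists_walk hr
    have hlen' : l.length = 2 * s := by omega
    exact mem_image.2 ⟨l, hlen' ▸ mem_walks hN l v hl, hlK⟩
  exact (card_le_card hsub).trans (card_image_le.trans (card_walks_le hD _ v))

end Counting

/-! ### Probabilities on finite types -/

section Probability

lemma prob_map {α β : Type*} (D : PMF α) (f : α → β) (s : Set β) :
    prob (D.map f) s = prob D (f ⁻¹' s) := by
  unfold prob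
  rw [PMF.toOuterMeasure_map_apply]

variable {α : Type*} [Fintype α]

open Classical in
lemma prob_eq_sum (D : PMF α) (s : Set α) :
    prob D s = ∑ x, if x ∈ s then (D x).toReal else 0 := by
  unfold prob
  rw [PMF.toOuterMeasure_apply_fintype, ENNReal.toReal_sum]
  · refine sum_congr rfl fun x _ => ?_
    by_cases h : x ∈ s <;> simp [h]
  · intro x _
    by_cases h : x ∈ s <;> simp [h, D.apply_ne_top]

lemma prob_mono (D : PMF α) {s t : Set α} (h : s ⊆ t) : prob D s ≤ prob D t := by
  classical
  rw [prob_eq_sum, prob_eq_sum]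
  refine sum_le_sum fun x _ => ?_
  by_cases hs : x ∈ s
  · simp [hs, h hs]
  · simp only [hs, if_false]
    split_ifs <;> simp

lemma prob_biUnion_le {ι : Type*} (D : PMF α) (I : Finset ι) (s : ι → Set α) :
    prob D (⋃ i ∈ I, s i) ≤ ∑ i ∈ I, prob D (s i) := by
  classical
  simp only [prob_eq_sum]
  rw [sum_comm]
  refine sum_le_sum fun x _ => ?_
  have hnn : ∀ i ∈ I, (0 : ℝ) ≤ if x ∈ s i then (D x).toReal else 0 := fun i _ => by
    split_ifs <;> simp
  by_cases h : x ∈ ⋃ i ∈ I, s i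
  · rw [if_pos h]
    simp only [Set.mem_iUnion, exists_prop] at h
    obtain ⟨i, hi, hx⟩ := h
    exact le_trans (by simp [hx]) (single_le_sum hnn hi)
  · rw [if_neg h]
    exact sum_nonneg hnn

lemma prob_union_le (D : PMF α) (s t : Set α) : prob D (s ∪ t) ≤ prob D s + prob D t := by
  classical
  simp only [prob_eq_sum]
  rw [← sum_add_distrib]
  refine sum_le_sum fun x _ => ?_
  have : 0 ≤ (D x).toReal := ENNReal.toReal_nonneg
  by_cases h₁ : x ∈ s <;> by_cases h₂ : x ∈ t <;> simp [h₁, h₂]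

lemma prob_add_prob_compl (D : PMF α) (s : Set α) : prob D s + prob D sᶜ = 1 := by
  classical
  have h : ∑ x, (D x).toReal = 1 := by
    rw [← ENNReal.toReal_sum fun x _ => D.apply_ne_top x, ← tsum_fintype (L := .unconditional α),
      D.tsum_coe, ENNReal.toReal_one]
  rw [prob_eq_sum, prob_eq_sum, ← sum_add_distrib, ← h]
  refine sum_congr rfl fun x _ => ?_
  by_cases h : x ∈ s <;> simp [h]

lemma IsIndependentNoise.isLocalStochasticNoise {V : Type*} [Fintype V] {D : PMF (Finset V)}
    {p : ℝ} (h : IsIndependentNoise D p) : IsLocalStochasticNoise D p := by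
  classical
  intro F
  have hsum : prob D {E | F ⊆ E} = ∑ E ∈ Finset.univ.filter (F ⊆ ·), prob D {E} := by
    rw [prob_eq_sum, sum_filter]
    refine sum_congr rfl fun E _ => ?_
    simp [prob_eq_sum]
  have hbij : ∑ E ∈ Finset.univ.filter (F ⊆ ·), prob D {E} =
      ∑ E ∈ Fᶜ.powerset, p ^ #F * (p ^ #E * (1 - p) ^ (#Fᶜ - #E)) := by
    refine sum_bij' (fun E _ => E \ F) (fun E _ => E ∪ F) ?_ ?_ ?_ ?_ ?_
    · intro E _
      exact mem_powerset.2 fun x hx => mem_compl.2 (mem_sdiff.1 hx).2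
    · simp
    · intro E hE
      simpa using (mem_filter.1 hE).2
    · intro E hE
      rw [mem_powerset] at hE
      rw [union_sdiff_cancel_right]
      exact disjoint_left.2 fun x hx => mem_compl.1 (hE hx)
    · intro E hE
      have hFE : F ⊆ E := (mem_filter.1 hE).2
      have h₁ := card_sdiff_add_card_eq_card hFE
      have h₂ := card_compl_add_card F
      rw [h E, ← mul_assoc, ← pow_add]
      congr 2 <;> omega
  rw [hsum, hbij, ← mul_sum, sum_pow_mul_eq_add_pow]
  simp

end Probability

/-! ### Percolation of the noise -/

/-- Below the threshold, local stochastic noise is unlikely to fill a fraction `1 / M` of some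
connected set of more than `t` qubits. -/
lemma prob_grown_le {V : Type*} [Fintype V] [DecidableEq V] {r : V → V → Prop}
    (hr : ∀ u w, r u w → r w u) {N : V → Finset V} (hN : ∀ u w, r u w → w ∈ N u) {d M : ℕ}
    (hd : 0 < d) (hM : 0 < M) (hNd : ∀ v, #(N v) ≤ d) {D : PMF (Finset V)} {p t : ℝ} (hp : 0 ≤ p)
    (hp₀ : p < (1 / (4 * (d : ℝ) ^ 2)) ^ M) (ht : 0 ≤ t) (hD : IsLocalStochasticNoise D p) :
    prob D {E | ∃ v K, Grown r v K ∧ t < #K ∧ #K ≤ M * #(E ∩ K)} ≤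
      Fintype.card V * (p / (1 / (4 * (d : ℝ) ^ 2)) ^ M) ^ (t / M) := by
  classical
  have hd' : (1 : ℝ) ≤ d := by exact_mod_cast hd
  have hd2 : (1 : ℝ) ≤ (d : ℝ) ^ 2 := one_le_pow₀ hd'
  set q : ℝ := 1 / (4 * (d : ℝ) ^ 2) with hq
  have hq0 : 0 < q := by positivity
  have hq1 : q ≤ 1 := by
    rw [hq, div_le_one (by positivity)]
    linarith
  have h2q : 2 * q ≤ 1 / 2 := by
    have : q ≤ 1 / (4 * 1) := by
      rw [hq]
      gcongr
    linarith
  have hdq : (d : ℝ) ^ 2 * (2 * q) = 1 / 2 := by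
    rw [hq]
    field_simp
    norm_num
  set ρ : ℝ := p / q ^ M with hρ
  have hρ0 : 0 ≤ ρ := by positivity
  have hρ1 : ρ ≤ 1 := by
    rw [hρ, div_le_one (by positivity)]
    exact hp₀.le
  set x : ℝ := ρ ^ (t / M) with hx
  have hx0 : 0 ≤ x := Real.rpow_nonneg hρ0 _
  have hpρ : p = q ^ M * ρ := by
    rw [hρ]
    field_simp
  have hM' : (0 : ℝ) < M := by exact_mod_cast hM
  let 𝒦 : V → ℕ → Finset (Finset V) := fun v s =>
    {K ∈ {K | Grown r v K ∧ #K = s + 1} | t < #K}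
  let 𝒮 : Finset V → Finset (Finset V) := fun K => {S ∈ K.powerset | #K ≤ M * #S}
  have hsub : {E : Finset V | ∃ v K, Grown r v K ∧ t < #K ∧ #K ≤ M * #(E ∩ K)} ⊆
      ⋃ v ∈ (univ : Finset V), ⋃ s ∈ range (Fintype.card V), ⋃ K ∈ 𝒦 v s, ⋃ S ∈ 𝒮 K,
        {E | S ⊆ E} := by
    rintro E ⟨v, K, hK, htK, hKE⟩
    have hpos : 0 < #K := card_pos.2 ⟨v, hK.mem⟩
    have hle : #K ≤ Fintype.card V := card_le_univ K
    simp only [Set.mem_iUnion, exists_prop]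
    refine ⟨v, mem_univ v, #K - 1, mem_range.2 (by omega), K, ?_, E ∩ K, ?_, ?_⟩
    · simp only [𝒦, mem_filter, mem_univ, true_and]
      exact ⟨⟨hK, by omega⟩, htK⟩
    · simp only [𝒮, mem_filter, mem_powerset]
      exact ⟨inter_subset_right, hKE⟩
    · exact inter_subset_left
  have hS : ∀ v s, ∀ K ∈ 𝒦 v s, ∀ S ∈ 𝒮 K, prob D {E | S ⊆ E} ≤ q ^ (s + 1) * x := by
    intro v s K hK S hS
    simp only [𝒦, 𝒮, mem_filter, mem_univ, true_and] at hK hS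
    have hKS : (#K : ℝ) ≤ M * #S := by exact_mod_cast hS.2
    -- In `p = q ^ M * ρ`, the power of `q` pays for the number of sets and `ρ` gives the decay.
    calc prob D {E | S ⊆ E} ≤ p ^ #S := hD S
      _ = q ^ (M * #S) * ρ ^ #S := by rw [hpρ, mul_pow, ← pow_mul]
      _ ≤ q ^ (s + 1) * x := by
        refine mul_le_mul ?_ ?_ (by positivity) (by positivity)
        · exact pow_le_pow_of_le_one hq0.le hq1 (by rw [← hK.1.2]; exact hS.2)
        · rw [← Real.rpow_natCast, hx]
          refine Real.rpow_le_rpow_of_exponent_ge' hρ0 hρ1 (by positivity) ?_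
          rw [div_le_iff₀ hM']
          linarith
  have hK : ∀ v s, ∀ K ∈ 𝒦 v s,
      prob D (⋃ S ∈ 𝒮 K, {E | S ⊆ E}) ≤ (2 * q) ^ (s + 1) * x := by
    intro v s K hK
    have hcard : #(𝒮 K) ≤ 2 ^ (s + 1) := by
      refine (card_filter_le _ _).trans ?_
      simp only [𝒦, mem_filter, mem_univ, true_and] at hK
      rw [card_powerset, hK.1.2]
    calc _ ≤ ∑ S ∈ 𝒮 K, prob D {E | S ⊆ E} := prob_biUnion_le _ _ _
      _ ≤ #(𝒮 K) • (q ^ (s + 1) * x) := sum_le_card_nsmul _ _ _ (hS v s K hK)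
      _ ≤ (2 : ℝ) ^ (s + 1) * (q ^ (s + 1) * x) := by
        rw [nsmul_eq_mul]
        gcongr
        exact_mod_cast hcard
      _ = _ := by rw [mul_pow]; ring
  have hs : ∀ v s, prob D (⋃ K ∈ 𝒦 v s, ⋃ S ∈ 𝒮 K, {E | S ⊆ E}) ≤ (1 / 2) ^ s * (x / 2) := by
    intro v s
    have hcard : #(𝒦 v s) ≤ d ^ (2 * s) :=
      (card_filter_le _ _).trans (card_grown_le hr hN hNd v s)
    calc _ ≤ ∑ K ∈ 𝒦 v s, prob D (⋃ S ∈ 𝒮 K, {E | S ⊆ E}) := prob_biUnion_le _ _ _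
      _ ≤ #(𝒦 v s) • ((2 * q) ^ (s + 1) * x) := sum_le_card_nsmul _ _ _ (hK v s)
      _ ≤ (d : ℝ) ^ (2 * s) * ((2 * q) ^ (s + 1) * x) := by
        rw [nsmul_eq_mul]
        gcongr
        exact_mod_cast hcard
      _ = ((d : ℝ) ^ 2 * (2 * q)) ^ s * (2 * q * x) := by
        rw [mul_pow ((d : ℝ) ^ 2), ← pow_mul]
        ring
      _ ≤ (1 / 2) ^ s * (x / 2) := by
        rw [hdq]
        gcongr
        nlinarith
  have hv : ∀ v ∈ (univ : Finset V), prob D (⋃ s ∈ range (Fintype.card V), ⋃ K ∈ 𝒦 v s,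
      ⋃ S ∈ 𝒮 K, {E | S ⊆ E}) ≤ x := by
    intro v _
    calc _ ≤ ∑ s ∈ range (Fintype.card V), prob D (⋃ K ∈ 𝒦 v s, ⋃ S ∈ 𝒮 K, {E | S ⊆ E}) :=
          prob_biUnion_le _ _ _
      _ ≤ ∑ s ∈ range (Fintype.card V), (1 / 2) ^ s * (x / 2) := sum_le_sum fun s _ => hs v s
      _ ≤ 2 * (x / 2) := by
        rw [← sum_mul]
        gcongr
        exact sum_geometric_two_le _
      _ = x := by ring
  calc _ ≤ _ := prob_mono D hsub
    _ ≤ ∑ v ∈ (univ : Finset V), prob D (⋃ s ∈ range (Fintype.card V), ⋃ K ∈ 𝒦 v s,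
          ⋃ S ∈ 𝒮 K, {E | S ⊆ E}) := prob_biUnion_le _ _ _
    _ ≤ #(univ : Finset V) • x := sum_le_card_nsmul _ _ _ hv
    _ = _ := by rw [nsmul_eq_mul, card_univ]

namespace CSSCode

variable {V CX CZ : Type*} [DecidableEq V] {Q : CSSCode V CX CZ} [Fintype V] [Fintype CX]
  [DecidableEq CX] [Fintype CZ]

/-- A code with bounded generators whose small errors can be flipped away is corrected, except with
small probability, by the decoder. -/
lemma prob_not_corrects_le {w : ℕ} (hw₀ : 0 < w) (hw : Q.IsBounded w) {t : ℝ} (ht₀ : 0 ≤ t)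
    (ht : Q.HasFlips t) {D : PMF (Finset V)} {p : ℝ} (hp : 0 ≤ p)
    (hp₀ : p < (1 / (4 * ((2 * w ^ 2 : ℕ) : ℝ) ^ 2)) ^ (1 + w * w))
    (hD : IsIndependentNoise D p ∨ IsLocalStochasticNoise D p) :
    prob D {E | ¬ Q.Corrects E} ≤ Fintype.card V *
      (p / (1 / (4 * ((2 * w ^ 2 : ℕ) : ℝ) ^ 2)) ^ (1 + w * w)) ^ (t / (1 + w * w : ℕ)) := by
  classical
  let N : V → Finset V := fun v =>
    (({c | v ∈ Q.suppX c} : Finset CX).biUnion Q.suppX) ∪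
      ({g | v ∈ Q.suppZ g} : Finset CZ).biUnion Q.suppZ
  have hN : ∀ u v, Q.Adj u v → v ∈ N u := by
    rintro u v (⟨c, hu, hv⟩ | ⟨g, hu, hv⟩)
    · exact mem_union_left _ (mem_biUnion.2 ⟨c, by simpa using hu, hv⟩)
    · exact mem_union_right _ (mem_biUnion.2 ⟨g, by simpa using hu, hv⟩)
  have hNd : ∀ v, #(N v) ≤ 2 * w ^ 2 := by
    intro v
    have h₁ := card_biUnion_le_card_mul ({c | v ∈ Q.suppX c} : Finset CX) Q.suppX w
      fun c _ => hw.card_suppX_le c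
    have h₂ := card_biUnion_le_card_mul ({g | v ∈ Q.suppZ g} : Finset CZ) Q.suppZ w
      fun g _ => hw.card_suppZ_le g
    have h₃ := Nat.mul_le_mul_right w (hw.degX_le v)
    have h₄ := Nat.mul_le_mul_right w (hw.degZ_le v)
    have h₅ := card_union_le (({c | v ∈ Q.suppX c} : Finset CX).biUnion Q.suppX)
      (({g | v ∈ Q.suppZ g} : Finset CZ).biUnion Q.suppZ)
    simp only [N]
    nlinarith
  have hD' : IsLocalStochasticNoise D p := hD.elim (fun h => h.isLocalStochasticNoise) id
  refine le_trans (prob_mono D fun E hE => ?_)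
    (prob_grown_le (r := Q.Adj) (fun u v h => h.symm) hN (by positivity) (by positivity) hNd hp
      hp₀ ht₀ hD')
  exact exists_grown_of_not_corrects hw ht hE

end CSSCode

/-! ### Unique neighbours in expanding sets -/

/-- If the neighbourhood of `S` is nearly as large as possible, some point of `S` shares few of its
neighbours with the rest of `S`. -/
lemma exists_few_shared {A B : Type*} [DecidableEq A] [DecidableEq B] {Γ : A → Finset B} {d : ℕ}
    (hΓ : ∀ a, #(Γ a) = d) {S : Finset A} (hS : S.Nonempty) {δ : ℝ}
    (h : (1 - δ) * d * #S ≤ #(S.biUnion Γ)) :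
    ∃ a ∈ S, (#{β ∈ Γ a | ∃ a' ∈ S, a' ≠ a ∧ β ∈ Γ a'} : ℝ) ≤ 2 * δ * d := by
  classical
  let χ : A → B → Prop := fun a β => β ∈ Γ a ∧ ∃ a' ∈ S, a' ≠ a ∧ β ∈ Γ a'
  set N := S.biUnion Γ with hN
  have hsub : ∀ a ∈ S, Γ a ⊆ N := fun a ha => subset_biUnion_of_mem Γ ha
  have h₁ : ∑ a ∈ S, #{β ∈ Γ a | ∃ a' ∈ S, a' ≠ a ∧ β ∈ Γ a'} = ∑ β ∈ N, #{a ∈ S | χ a β} := by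
    have := sum_card_bipartiteAbove_eq_sum_card_bipartiteBelow (s := S) (t := N) χ
    unfold bipartiteAbove bipartiteBelow at this
    rw [← this]
    refine sum_congr rfl fun a ha => congrArg card ?_
    ext β
    have := @hsub a ha β
    simp only [mem_filter, χ]
    tauto
  have h₂ : S.card * d = ∑ β ∈ N, #{a ∈ S | β ∈ Γ a} := by
    have := sum_card_bipartiteAbove_eq_sum_card_bipartiteBelow (s := S) (t := N)
      (fun a β => β ∈ Γ a)
    unfold bipartiteAbove bipartiteBelow at this
    rw [← this, ← smul_eq_mul, ← sum_const]
    refine sum_congr rfl fun a ha => ?_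
    rw [← hΓ a]
    congr 1
    ext β
    have := @hsub a ha β
    simp only [mem_filter]
    tauto
  have h₃ : ∀ β ∈ N, #{a ∈ S | χ a β} + 2 ≤ 2 * #{a ∈ S | β ∈ Γ a} := by
    intro β hβ
    obtain ⟨a₀, ha₀, hβa₀⟩ := mem_biUnion.1 hβ
    have hle : #{a ∈ S | χ a β} ≤ #{a ∈ S | β ∈ Γ a} :=
      card_le_card fun a ha => by
        simp only [mem_filter, χ] at ha ⊢
        exact ⟨ha.1, ha.2.1⟩
    have hpos : 0 < #{a ∈ S | β ∈ Γ a} := card_pos.2 ⟨a₀, by simp [ha₀, hβa₀]⟩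
    rcases ({a ∈ S | χ a β} : Finset A).eq_empty_or_nonempty with he | ⟨a, ha⟩
    · rw [he, card_empty]
      omega
    · simp only [mem_filter, χ] at ha
      obtain ⟨haS, haβ, a', ha'S, hne, ha'β⟩ := ha
      have : 1 < #{a ∈ S | β ∈ Γ a} :=
        one_lt_card.2 ⟨a', by simp [ha'S, ha'β], a, by simp [haS, haβ], hne⟩
      omega
  have h₄ : ∑ a ∈ S, #{β ∈ Γ a | ∃ a' ∈ S, a' ≠ a ∧ β ∈ Γ a'} + #N * 2 ≤ 2 * (#S * d) := by
    rw [h₁, h₂, mul_sum, ← smul_eq_mul (#N), ← sum_const, ← sum_add_distrib]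
    exact sum_le_sum h₃
  have h₅ : (∑ a ∈ S, (#{β ∈ Γ a | ∃ a' ∈ S, a' ≠ a ∧ β ∈ Γ a'} : ℝ)) + #N * 2 ≤
      2 * (#S * d) := by exact_mod_cast h₄
  refine exists_le_of_sum_le hS ?_
  rw [sum_const, nsmul_eq_mul]
  linarith

/-- Here `p / dB` and `r / dA` are the fractions of the two halves of a generator that are
flipped. After multiplication by `p * dA + r * dB`, the claim is that a quadratic form is positive
definite, and the hypothesis on `δA` and `δB` is the condition on its discriminant. -/
lemma gain_pos_aux {δA δB p r dA dB : ℝ} (hδA : 0 < δA) (hδB : 0 < δB)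
    (hexp : δA + δB + (δB - δA) ^ 2 < 1 / 4) (hdA : 0 < dA) (hdB : 0 < dB) (hp : 0 ≤ p)
    (hr : 0 ≤ r) (hpr : 0 < p + r) (hle : p * dA + r * dB ≤ dA * dB) :
    0 < p * dA + r * dB - 2 * p * r - 2 * p * (2 * δA * dA) - 2 * r * (2 * δB * dB) := by
  set X := p * dA with hX
  set Y := r * dB with hY
  have hX0 : 0 ≤ X := by positivity
  have hY0 : 0 ≤ Y := by positivity
  have hS : 0 < X + Y := by
    rcases hp.lt_or_eq with h | h
    · have : 0 < X := by positivity
      linarith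
    · have : 0 < r := by linarith
      have : 0 < Y := by positivity
      linarith
  have hXY : (X + Y) * (p * r) ≤ X * Y := by
    have := mul_le_mul_of_nonneg_right hle (mul_nonneg hp hr)
    calc _ ≤ _ := this
      _ = X * Y := by rw [hX, hY]; ring
  have ha : 0 < 1 - 4 * δA := by nlinarith [sq_nonneg (δB - δA)]
  have hb : 0 < 1 - 4 * δB := by nlinarith [sq_nonneg (δB - δA)]
  have hdisc : 0 < (1 - 4 * δA) * (1 - 4 * δB) - (2 * (δA + δB)) ^ 2 := by nlinarith
  have hform : 0 < (1 - 4 * δA) * X ^ 2 + (1 - 4 * δB) * Y ^ 2 - 4 * (δA + δB) * X * Y := by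
    have hmul : 0 < (1 - 4 * δA) * ((1 - 4 * δA) * X ^ 2 + (1 - 4 * δB) * Y ^ 2 -
        4 * (δA + δB) * X * Y) := by
      have heq : (1 - 4 * δA) * ((1 - 4 * δA) * X ^ 2 + (1 - 4 * δB) * Y ^ 2 -
          4 * (δA + δB) * X * Y) = ((1 - 4 * δA) * X - 2 * (δA + δB) * Y) ^ 2 +
          ((1 - 4 * δA) * (1 - 4 * δB) - (2 * (δA + δB)) ^ 2) * Y ^ 2 := by ring
      rw [heq]
      rcases hY0.lt_or_eq with h | h
      · exact add_pos_of_nonneg_of_pos (sq_nonneg _) (mul_pos hdisc (pow_pos h 2))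
      · have : 0 < X := by linarith
        rw [← h]
        have : 0 < (1 - 4 * δA) * X := mul_pos ha this
        simp only [mul_zero, sub_zero]
        positivity
    exact pos_of_mul_pos_right hmul ha.le
  refine pos_of_mul_pos_right (a := X + Y) ?_ hS.le
  have heq : (X + Y) * (X + Y - 2 * p * r - 2 * p * (2 * δA * dA) - 2 * r * (2 * δB * dB)) =
      ((1 - 4 * δA) * X ^ 2 + (1 - 4 * δB) * Y ^ 2 - 4 * (δA + δB) * X * Y) +
        2 * (X * Y - (X + Y) * (p * r)) := by
    rw [hX, hY]
    ring
  rw [heq]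
  linarith

/-! ### Flips in quantum expander codes -/

section Expander

lemma mem_leftNbr {A B : Type*} [Fintype B] {G : A → B → Prop} [DecidableRel G] {a : A} {b : B} :
    b ∈ leftNbr G a ↔ G a b := by simp [leftNbr]

lemma mem_rightNbr {A B : Type*} [Fintype A] {G : A → B → Prop} [DecidableRel G] {a : A} {b : B} :
    a ∈ rightNbr G b ↔ G a b := by simp [rightNbr]

variable {A B : Type*} [Fintype A] [Fintype B] [DecidableEq A] [DecidableEq B]
  {G : A → B → Prop} [DecidableRel G]

lemma card_suppX_inter (α : A) (β : B) (E : Finset (Qubit A B)) :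
    #((expanderCode G).suppX (α, β) ∩ E) =
      #{a ∈ rightNbr G β | Sum.inl (α, a) ∈ E} + #{b ∈ leftNbr G α | Sum.inr (b, β) ∈ E} := by
  have h : (expanderCode G).suppX (α, β) ∩ E =
      (({α} ×ˢ ({a ∈ rightNbr G β | Sum.inl (α, a) ∈ E} : Finset A)).disjSum
        (({b ∈ leftNbr G α | Sum.inr (b, β) ∈ E} : Finset B) ×ˢ {β})) := by
    ext x
    rcases x with ⟨x, y⟩ | ⟨x, y⟩ <;> simp [expanderCode] <;> grind
  rw [h, card_disjSum, card_product, card_product, card_singleton, card_singleton, one_mul,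
    mul_one]

lemma card_filter_of_unique {α : Type*} {s : Finset α} {P : α → Prop} [DecidablePred P]
    {x : α} (h : ∀ y ∈ s, P y → y = x) [Decidable (x ∈ s ∧ P x)] :
    #{y ∈ s | P y} = if x ∈ s ∧ P x then 1 else 0 := by
  split_ifs with hx
  · rw [card_eq_one]
    refine ⟨x, ?_⟩
    ext y
    simp only [mem_filter, mem_singleton]
    exact ⟨fun hy => h y hy.1 hy.2, fun hy => hy ▸ hx⟩
  · rw [card_eq_zero, filter_eq_empty_iff]
    intro y hy hPy
    have := h y hy hPy
    subst this
    exact hx ⟨hy, hPy⟩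

/-- A check that meets an error at most at one given qubit of each type. -/
lemma mem_syndrome_of_unique {E : Finset (Qubit A B)} {α a : A} {β b : B}
    (h₁ : ∀ a' ∈ rightNbr G β, Sum.inl (α, a') ∈ E → a' = a)
    (h₂ : ∀ b' ∈ leftNbr G α, Sum.inr (b', β) ∈ E → b' = b) :
    (α, β) ∈ (expanderCode G).syndrome E ↔
      Xor (G a β ∧ Sum.inl (α, a) ∈ E) (G α b ∧ Sum.inr (b, β) ∈ E) := by
  classical
  rw [CSSCode.mem_syndrome, card_suppX_inter, card_filter_of_unique h₁, card_filter_of_unique h₂]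
  simp only [mem_leftNbr, mem_rightNbr]
  by_cases h₃ : G a β ∧ Sum.inl (α, a) ∈ E <;> by_cases h₄ : G α b ∧ Sum.inr (b, β) ∈ E <;>
    simp [h₃, h₄, xor_def]

/-- The gain from flipping the part `P`, `R` of the support of the `X`-type generator `(b, a)` when
the syndrome is known to contain two rectangles of checks. -/
lemma le_gain {a : A} {b : B} {Ua R : Finset B} {Ub P : Finset A} (hUa : Ua ⊆ leftNbr G a)
    (hUb : Ub ⊆ rightNbr G b) (hP : P ⊆ Ub) (hR : R ⊆ Ua) {σ : Finset (A × B)}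
    (h₁ : ∀ α ∈ P, ∀ β ∈ Ua \ R, (α, β) ∈ σ) (h₂ : ∀ α ∈ Ub \ P, ∀ β ∈ R, (α, β) ∈ σ) :
    (#P * #(Ua \ R) + #(Ub \ P) * #R - #P * #(leftNbr G a \ Ua) -
      #(rightNbr G b \ Ub) * #R : ℤ) ≤
      (expanderCode G).gain σ ((P ×ˢ {a}).disjSum ({b} ×ˢ R)) := by
  have hmem : ∀ α β, (α, β) ∈ (expanderCode G).syndrome ((P ×ˢ {a}).disjSum ({b} ×ˢ R)) ↔
      Xor (G a β ∧ α ∈ P) (G α b ∧ β ∈ R) := by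
    intro α β
    rw [mem_syndrome_of_unique (a := a) (b := b) (by simp +contextual [eq_comm])
      (by simp +contextual [eq_comm])]
    simp
  set ρ := (expanderCode G).syndrome ((P ×ˢ {a}).disjSum ({b} ×ˢ R)) with hρ
  have hGa : ∀ β ∈ Ua, G a β := fun β hβ => mem_leftNbr.1 (hUa hβ)
  have hGb : ∀ α ∈ Ub, G α b := fun α hα => mem_rightNbr.1 (hUb hα)
  have hdisj : Disjoint (P ×ˢ (Ua \ R)) ((Ub \ P) ×ˢ R) := by
    refine disjoint_left.2 fun c hc hc' => ?_
    simp only [mem_product, mem_sdiff] at hc hc'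
    exact hc'.1.2 hc.1
  have hlow : P ×ˢ (Ua \ R) ∪ (Ub \ P) ×ˢ R ⊆ σ ∩ ρ := by
    rintro ⟨α, β⟩ hc
    rw [mem_inter, hmem]
    simp only [mem_union, mem_product, mem_sdiff] at hc
    rcases hc with ⟨hα, hβ, hβR⟩ | ⟨⟨hα, hαP⟩, hβ⟩
    · exact ⟨h₁ α hα β (mem_sdiff.2 ⟨hβ, hβR⟩), Or.inl ⟨⟨hGa β hβ, hα⟩, fun h => hβR h.2⟩⟩
    · exact ⟨h₂ α (mem_sdiff.2 ⟨hα, hαP⟩) β hβ, Or.inr ⟨⟨hGb α hα, hβ⟩, fun h => hαP h.2⟩⟩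
  have hup : ρ ⊆ (P ×ˢ (Ua \ R) ∪ (Ub \ P) ×ˢ R) ∪
      (P ×ˢ (leftNbr G a \ Ua) ∪ (rightNbr G b \ Ub) ×ˢ R) := by
    rintro ⟨α, β⟩ hc
    rw [hmem] at hc
    simp only [mem_union, mem_product, mem_sdiff, mem_leftNbr, mem_rightNbr]
    have := @hP α
    have := @hR β
    have := hGa β
    have := hGb α
    rcases hc with hc | hc <;> tauto
  have hlow' := card_le_card hlow
  have hup' := (card_le_card hup).trans (card_union_le _ _)
  have hup'' := card_union_le (P ×ˢ (leftNbr G a \ Ua)) ((rightNbr G b \ Ub) ×ˢ R)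
  rw [card_union_of_disjoint hdisj] at hlow' hup'
  simp only [card_product] at hlow' hup' hup''
  rw [CSSCode.gain_eq, ← hρ]
  zify at hlow' hup' hup''
  linarith

/-- A critical generator of a small error: on a large part of its support, the checks meet the error
in that support only. -/
lemma exists_critical {dA dB : ℕ} (hdA : 0 < dA) (hdB : 0 < dB) {γA δA γB δB : ℝ} (hδA : 0 < δA)
    (hδB : 0 < δB) (hG : IsBiregular G dA dB) (hA : IsLeftExpanding G dA γA δA)
    (hB : IsRightExpanding G dB γB δB) {E : Finset (Qubit A B)} (hE : E.Nonempty)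
    (hEA : (#E : ℝ) ≤ γA * Fintype.card A) (hEB : (#E : ℝ) ≤ γB * Fintype.card B) :
    ∃ (a : A) (b : B) (Ua : Finset B) (Ub : Finset A), Ua ⊆ leftNbr G a ∧ Ub ⊆ rightNbr G b ∧
      (#(leftNbr G a \ Ua) : ℝ) ≤ 2 * δA * dA ∧ (#(rightNbr G b \ Ub) : ℝ) ≤ 2 * δB * dB ∧
      (∀ α ∈ Ub, ∀ β ∈ Ua, (∀ a' ∈ rightNbr G β, Sum.inl (α, a') ∈ E → a' = a) ∧
        ∀ b' ∈ leftNbr G α, Sum.inr (b', β) ∈ E → b' = b) ∧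
      ((∃ α ∈ Ub, Sum.inl (α, a) ∈ E) ∨ ∃ β ∈ Ua, Sum.inr (b, β) ∈ E) := by
  classical
  have hcardA : ∀ T ⊆ E, (#T : ℝ) ≤ γA * Fintype.card A := fun T hT =>
    le_trans (by exact_mod_cast card_le_card hT) hEA
  -- Among the rows of the error in `B × B` with an entry in `U`, one has few shared neighbours.
  have hrow : ∀ U : Finset B, (∃ b, ∃ β ∈ U, Sum.inr (b, β) ∈ E) →
      ∃ b, (∃ β ∈ U, Sum.inr (b, β) ∈ E) ∧ ∃ Ub ⊆ rightNbr G b,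
        (#(rightNbr G b \ Ub) : ℝ) ≤ 2 * δB * dB ∧
        ∀ α ∈ Ub, ∀ β ∈ U, ∀ b' ∈ leftNbr G α, Sum.inr (b', β) ∈ E → b' = b := by
    rintro U ⟨b₀, β₀, hβ₀, hb₀⟩
    set S : Finset B := {b | ∃ β ∈ U, Sum.inr (b, β) ∈ E} with hS
    have hSE : #S ≤ #E := by
      have : S ⊆ E.biUnion fun x => Sum.elim (fun _ => ∅) (fun y => {y.1}) x := by
        intro b hb
        simp only [hS, mem_filter, mem_univ, true_and] at hb
        obtain ⟨β, -, hβ⟩ := hb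
        exact mem_biUnion.2 ⟨_, hβ, by simp⟩
      refine (card_le_card this).trans ((card_biUnion_le_card_mul _ _ 1 fun x _ => ?_).trans ?_)
      · rcases x with x | x <;> simp
      · rw [mul_one]
    obtain ⟨b, hb, hfew⟩ := exists_few_shared hG.2 (S := S) ⟨b₀, by simpa [hS] using ⟨β₀, hβ₀, hb₀⟩⟩
      (hB S (le_trans (by exact_mod_cast hSE) hEB))
    refine ⟨b, by simpa [hS] using hb, {α ∈ rightNbr G b | ¬ ∃ b' ∈ S, b' ≠ b ∧ α ∈ rightNbr G b'},
      filter_subset _ _, ?_, ?_⟩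
    · rw [← filter_not]
      simpa only [not_not] using hfew
    · intro α hα β hβ b' hb' hE'
      by_contra hne
      refine (mem_filter.1 hα).2 ⟨b', ?_, hne, mem_rightNbr.2 (mem_leftNbr.1 hb')⟩
      simpa [hS] using ⟨β, hβ, hE'⟩
  have hdA' : (0 : ℝ) ≤ 2 * δA * dA := by positivity
  have hdB' : (0 : ℝ) ≤ 2 * δB * dB := by positivity
  by_cases hX : ∃ a α, Sum.inl (α, a) ∈ E
  · obtain ⟨a₀, α₀, hα₀⟩ := hX
    set S : Finset A := {a | ∃ α, Sum.inl (α, a) ∈ E} with hS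
    have hSE : #S ≤ #E := by
      have : S ⊆ E.biUnion fun x => Sum.elim (fun y => {y.2}) (fun _ => ∅) x := by
        intro a ha
        simp only [hS, mem_filter, mem_univ, true_and] at ha
        obtain ⟨α, hα⟩ := ha
        exact mem_biUnion.2 ⟨_, hα, by simp⟩
      refine (card_le_card this).trans ((card_biUnion_le_card_mul _ _ 1 fun x _ => ?_).trans ?_)
      · rcases x with x | x <;> simp
      · rw [mul_one]
    obtain ⟨a, ha, hfew⟩ := exists_few_shared hG.1 (S := S) ⟨a₀, by simpa [hS] using ⟨α₀, hα₀⟩⟩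
      (hA S (le_trans (by exact_mod_cast hSE) hEA))
    set Ua : Finset B := {β ∈ leftNbr G a | ¬ ∃ a' ∈ S, a' ≠ a ∧ β ∈ leftNbr G a'} with hUa
    have hUa₁ : (#(leftNbr G a \ Ua) : ℝ) ≤ 2 * δA * dA := by
      rw [hUa, ← filter_not]
      simpa only [not_not] using hfew
    have hUa₂ : ∀ α, ∀ β ∈ Ua, ∀ a' ∈ rightNbr G β, Sum.inl (α, a') ∈ E → a' = a := by
      intro α β hβ a' ha' hE'
      by_contra hne
      refine (mem_filter.1 hβ).2 ⟨a', ?_, hne, mem_leftNbr.2 (mem_rightNbr.1 ha')⟩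
      simpa [hS] using ⟨α, hE'⟩
    by_cases hY : ∃ b, ∃ β ∈ Ua, Sum.inr (b, β) ∈ E
    · obtain ⟨b, hb, Ub, hUb, hUb₁, hUb₂⟩ := hrow Ua hY
      exact ⟨a, b, Ua, Ub, filter_subset _ _, hUb, hUa₁, hUb₁,
        fun α hα β hβ => ⟨hUa₂ α β hβ, hUb₂ α hα β hβ⟩, Or.inr hb⟩
    · simp only [hS, mem_filter, mem_univ, true_and] at ha
      obtain ⟨α, hα⟩ := ha
      obtain ⟨b, hb⟩ := card_pos.1 (hdA.trans_eq (hG.1 α).symm)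
      refine ⟨a, b, Ua, rightNbr G b, filter_subset _ _, subset_rfl, hUa₁, by simpa using hdB',
        fun α' _ β hβ => ⟨hUa₂ α' β hβ, fun b' _ hb' => (hY ⟨b', β, hβ, hb'⟩).elim⟩,
        Or.inl ⟨α, mem_rightNbr.2 (mem_leftNbr.1 hb), hα⟩⟩
  · have hY : ∃ b, ∃ β ∈ (univ : Finset B), Sum.inr (b, β) ∈ E := by
      obtain ⟨⟨α, a⟩ | ⟨b, β⟩, hx⟩ := hE
      · exact (hX ⟨a, α, hx⟩).elim
      · exact ⟨b, β, mem_univ _, hx⟩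
    obtain ⟨b, ⟨β, -, hβ⟩, Ub, hUb, hUb₁, hUb₂⟩ := hrow univ hY
    obtain ⟨a, ha⟩ := card_pos.1 (hdB.trans_eq (hG.2 β).symm)
    exact ⟨a, b, leftNbr G a, Ub, subset_rfl, hUb, by simpa using hdA', hUb₁,
      fun α hα β' _ => ⟨fun a' _ ha' => (hX ⟨a', α, ha'⟩).elim, hUb₂ α hα β' (mem_univ _)⟩,
      Or.inr ⟨β, mem_leftNbr.2 (mem_rightNbr.1 ha), hβ⟩⟩

/-- Small errors in a quantum expander code can be flipped away. In a critical generator one flips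
either the part in the error or the part outside it, whichever occupies the smaller fraction. -/
lemma hasFlips_expanderCode {dA dB : ℕ} (hdA : 0 < dA) (hdB : 0 < dB) {γA δA γB δB : ℝ}
    (hδA : 0 < δA) (hδB : 0 < δB) (hexp : δA + δB + (δB - δA) ^ 2 < 1 / 4)
    (hG : IsBiregular G dA dB) (hA : IsLeftExpanding G dA γA δA)
    (hB : IsRightExpanding G dB γB δB) :
    (expanderCode G).HasFlips (min (γA * Fintype.card A) (γB * Fintype.card B)) := by
  intro E hE hcard hred
  obtain ⟨a, b, Ua, Ub, hUa, hUb, hχa, hχb, huniq, hne⟩ := exists_critical hdA hdB hδA hδB hG hA hB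
    hE (hcard.trans (min_le_left _ _)) (hcard.trans (min_le_right _ _))
  have hdA' : (0 : ℝ) < dA := by exact_mod_cast hdA
  have hdB' : (0 : ℝ) < dB := by exact_mod_cast hdB
  have hsyn : ∀ α ∈ Ub, ∀ β ∈ Ua, ((α, β) ∈ (expanderCode G).syndrome E ↔
      Xor (Sum.inl (α, a) ∈ E) (Sum.inr (b, β) ∈ E)) := by
    intro α hα β hβ
    rw [mem_syndrome_of_unique (huniq α hα β hβ).1 (huniq α hα β hβ).2]
    simp [mem_leftNbr.1 (hUa hβ), mem_rightNbr.1 (hUb hα)]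
  have hUacard : (#(leftNbr G a \ Ua) : ℝ) + #Ua = dA := by
    exact_mod_cast (card_sdiff_add_card_eq_card hUa).trans (hG.1 a)
  have hUbcard : (#(rightNbr G b \ Ub) : ℝ) + #Ub = dB := by
    exact_mod_cast (card_sdiff_add_card_eq_card hUb).trans (hG.2 b)
  -- The flip of any part of the generator with this syndrome that is not too large.
  have main : ∀ P ⊆ Ub, ∀ R ⊆ Ua,
      (∀ α ∈ P, ∀ β ∈ Ua \ R, (α, β) ∈ (expanderCode G).syndrome E) →
      (∀ α ∈ Ub \ P, ∀ β ∈ R, (α, β) ∈ (expanderCode G).syndrome E) →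
      0 < #P + #R → (#P * dA + #R * dB : ℝ) ≤ dA * dB →
      ∃ F, (expanderCode G).IsSmallSet F ∧
        0 < (expanderCode G).gain ((expanderCode G).syndrome E) F := by
    intro P hP R hR h₁ h₂ hpos hle
    refine ⟨(P ×ˢ {a}).disjSum ({b} ×ˢ R), ⟨?_, (b, a), ?_⟩, ?_⟩
    · rw [← card_pos]
      simpa using hpos
    · exact disjSum_mono (product_subset_product_left (hP.trans hUb))
        (product_subset_product_right (hR.trans hUa))
    · have hgain := le_gain hUa hUb hP hR h₁ h₂
      have hgain' : ((#P * #(Ua \ R) + #(Ub \ P) * #R - #P * #(leftNbr G a \ Ua) -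
          #(rightNbr G b \ Ub) * #R : ℝ)) ≤ (((expanderCode G).gain
            ((expanderCode G).syndrome E) ((P ×ˢ {a}).disjSum ({b} ×ˢ R)) : ℤ) : ℝ) := by
        exact_mod_cast hgain
      have hRc : (#(Ua \ R) : ℝ) + #R = #Ua := by
        exact_mod_cast card_sdiff_add_card_eq_card hR
      have hPc : (#(Ub \ P) : ℝ) + #P = #Ub := by
        exact_mod_cast card_sdiff_add_card_eq_card hP
      have hpos' : (0 : ℝ) < #P + #R := by exact_mod_cast hpos
      have hq := gain_pos_aux hδA hδB hexp hdA' hdB' (Nat.cast_nonneg #P) (Nat.cast_nonneg #R)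
        hpos' hle
      have hχa' := mul_le_mul_of_nonneg_left hχa (Nat.cast_nonneg (α := ℝ) #P)
      have hχb' := mul_le_mul_of_nonneg_left hχb (Nat.cast_nonneg (α := ℝ) #R)
      have e₁ : (#(Ua \ R) : ℝ) = dA - #(leftNbr G a \ Ua) - #R := by linarith
      have e₂ : (#(Ub \ P) : ℝ) = dB - #(rightNbr G b \ Ub) - #P := by linarith
      rw [e₁, e₂] at hgain'
      have : (0 : ℝ) < (((expanderCode G).gain
            ((expanderCode G).syndrome E) ((P ×ˢ {a}).disjSum ({b} ×ˢ R)) : ℤ) : ℝ) := by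
        nlinarith
      exact_mod_cast this
  set P : Finset A := {α ∈ Ub | Sum.inl (α, a) ∈ E} with hP
  set R : Finset B := {β ∈ Ua | Sum.inr (b, β) ∈ E} with hR
  have hPU : P ⊆ Ub := filter_subset _ _
  have hRU : R ⊆ Ua := filter_subset _ _
  have h₁ : ∀ α ∈ P, ∀ β ∈ Ua \ R, (α, β) ∈ (expanderCode G).syndrome E := by
    intro α hα β hβ
    simp only [hP, hR, mem_filter, mem_sdiff] at hα hβ
    rw [hsyn α hα.1 β hβ.1]
    exact Or.inl ⟨hα.2, fun h => hβ.2 ⟨hβ.1, h⟩⟩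
  have h₂ : ∀ α ∈ Ub \ P, ∀ β ∈ R, (α, β) ∈ (expanderCode G).syndrome E := by
    intro α hα β hβ
    simp only [hP, hR, mem_filter, mem_sdiff] at hα hβ
    rw [hsyn α hα.1 β hβ.1]
    exact Or.inr ⟨hβ.2, fun h => hα.2 ⟨hα.1, h⟩⟩
  have hPc : (#(Ub \ P) : ℝ) + #P = #Ub := by exact_mod_cast card_sdiff_add_card_eq_card hPU
  have hRc : (#(Ua \ R) : ℝ) + #R = #Ua := by exact_mod_cast card_sdiff_add_card_eq_card hRU
  by_cases hsmall : (#P * dA + #R * dB : ℝ) ≤ dA * dB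
  · refine main P hPU R hRU h₁ h₂ ?_ hsmall
    rcases hne with ⟨α, hα, hαE⟩ | ⟨β, hβ, hβE⟩
    · have : 0 < #P := card_pos.2 ⟨α, mem_filter.2 ⟨hα, hαE⟩⟩
      omega
    · have : 0 < #R := card_pos.2 ⟨β, mem_filter.2 ⟨hβ, hβE⟩⟩
      omega
  · refine main (Ub \ P) sdiff_subset (Ua \ R) sdiff_subset ?_ ?_ ?_ ?_
    · rwa [Finset.sdiff_sdiff_eq_self hRU]
    · rwa [Finset.sdiff_sdiff_eq_self hPU]
    · -- Otherwise the error would contain most of the generator and would not be reduced.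
      by_contra hzero
      have hP0 : (#(Ub \ P) : ℝ) = 0 := by
        exact_mod_cast (by omega : #(Ub \ P) = 0)
      have hR0 : (#(Ua \ R) : ℝ) = 0 := by
        exact_mod_cast (by omega : #(Ua \ R) = 0)
      have hsub : (P ×ˢ {a}).disjSum ({b} ×ˢ R) ⊆ E ∩ (expanderCode G).suppZ (b, a) := by
        refine subset_inter ?_ (disjSum_mono (product_subset_product_left (hPU.trans hUb))
          (product_subset_product_right (hRU.trans hUa)))
        rintro (⟨x, y⟩ | ⟨x, y⟩) hx
        · simp only [hP, inl_mem_disjSum, mem_product, mem_filter, mem_singleton] at hx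
          rw [hx.2]
          exact hx.1.2
        · simp only [hR, inr_mem_disjSum, mem_product, mem_filter, mem_singleton] at hx
          rw [hx.1]
          exact hx.2.2
      have hc₁ := card_le_card hsub
      have hc₂ := card_symmDiff_add E ((expanderCode G).suppZ (b, a))
      have hc₃ := hred (b, a)
      have hc₄ : #((expanderCode G).suppZ (b, a)) = dB + dA := by
        simp [expanderCode, hG.1 a, hG.2 b]
      have hc₅ : 2 * #P + 2 * #R ≤ dB + dA := by
        simp only [card_disjSum, card_product, card_singleton, one_mul, mul_one] at hc₁
        omega
      have hc₆ : (2 * #P + 2 * #R : ℝ) ≤ dB + dA := by exact_mod_cast hc₅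
      nlinarith [sq_nonneg (δB - δA)]
    · have e₁ : (#(Ub \ P) : ℝ) = #Ub - #P := by linarith
      have e₂ : (#(Ua \ R) : ℝ) = #Ua - #R := by linarith
      have l₁ : (#Ub : ℝ) ≤ dB := by
        have : (0 : ℝ) ≤ #(rightNbr G b \ Ub) := Nat.cast_nonneg _
        linarith
      have l₂ : (#Ua : ℝ) ≤ dA := by
        have : (0 : ℝ) ≤ #(leftNbr G a \ Ua) := Nat.cast_nonneg _
        linarith
      have l₃ := mul_le_mul_of_nonneg_right l₁ hdA'.le
      have l₄ := mul_le_mul_of_nonneg_right l₂ hdB'.le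
      rw [e₁, e₂]
      push Not at hsmall
      linarith

end Expander

/-! ### The dual code and the parameters of the code -/

lemma CSSCode.IsBounded.dual {V CX CZ : Type*} [DecidableEq V] [Fintype CX] [Fintype CZ]
    {Q : CSSCode V CX CZ} {w : ℕ} (h : Q.IsBounded w) : Q.dual.IsBounded w :=
  ⟨h.card_suppZ_le, h.card_suppX_le, h.degZ_le, h.degX_le⟩

lemma CSSCode.HasFlips.mono {V CX CZ : Type*} [DecidableEq V] [Fintype CX] [DecidableEq CX]
    {Q : CSSCode V CX CZ} {t t' : ℝ} (h : Q.HasFlips t) (ht : t' ≤ t) : Q.HasFlips t' :=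
  fun E hE hcard => h E hE (hcard.trans ht)

lemma CSSCode.HasFlips.map {V V' CX CZ : Type*} [DecidableEq V] [DecidableEq V'] [Fintype CX]
    [DecidableEq CX] {Q : CSSCode V CX CZ} {Q' : CSSCode V' CX CZ} (e : V ≃ V')
    (hX : ∀ c, Q'.suppX c = (Q.suppX c).map e.toEmbedding)
    (hZ : ∀ g, Q'.suppZ g = (Q.suppZ g).map e.toEmbedding) {t : ℝ} (h : Q.HasFlips t) :
    Q'.HasFlips t := by
  have hsyn : ∀ E, Q'.syndrome (E.map e.toEmbedding) = Q.syndrome E := by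
    intro E
    ext c
    rw [mem_syndrome, mem_syndrome, hX, ← map_inter, card_map]
  have hsd : ∀ E E' : Finset V, symmDiff (E.map e.toEmbedding) (E'.map e.toEmbedding) =
      (symmDiff E E').map e.toEmbedding := by
    intro E E'
    simp only [map_eq_image, Equiv.coe_toEmbedding]
    exact (image_symmDiff _ _ e.injective).symm
  intro E' hE' hcard hred
  obtain ⟨E, rfl⟩ : ∃ E : Finset V, E' = E.map e.toEmbedding :=
    ⟨E'.map e.symm.toEmbedding, by ext x; simp⟩
  obtain ⟨F, ⟨hF, g, hFg⟩, hgain⟩ := h E (by simpa using hE') (by simpa using hcard) fun g => by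
    have := hred g
    rwa [hZ, hsd, card_map, card_map] at this
  refine ⟨F.map e.toEmbedding, ⟨by simpa using hF, g, ?_⟩, ?_⟩
  · rw [hZ]
    exact map_subset_map.2 hFg
  · rw [gain_eq] at hgain ⊢
    rwa [hsyn, hsyn]

section Expander

variable {A : Type u} {B : Type v} [Fintype A] [Fintype B] [DecidableEq A] [DecidableEq B]
  {G : A → B → Prop} [DecidableRel G]

lemma isBounded_expanderCode {dA dB : ℕ} (hG : IsBiregular G dA dB) :
    (expanderCode G).IsBounded (dA + dB) where
  card_suppX_le c := by
    simp [expanderCode, hG.1 c.1, hG.2 c.2, add_comm]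
  card_suppZ_le g := by
    simp [expanderCode, hG.1 g.2, hG.2 g.1, add_comm]
  degX_le v := by
    rcases v with ⟨α, a⟩ | ⟨b, β⟩
    · have h : ({c | Sum.inl (α, a) ∈ (expanderCode G).suppX c} : Finset (A × B)) =
          {α} ×ˢ leftNbr G a := by
        ext ⟨x, y⟩
        simp [expanderCode, mem_leftNbr, mem_rightNbr, eq_comm]
      rw [h, card_product, card_singleton, hG.1 a]
      omega
    · have h : ({c | Sum.inr (b, β) ∈ (expanderCode G).suppX c} : Finset (A × B)) =
          rightNbr G b ×ˢ {β} := by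
        ext ⟨x, y⟩
        simp [expanderCode, mem_leftNbr, mem_rightNbr, eq_comm]
      rw [h, card_product, card_singleton, hG.2 b]
      omega
  degZ_le v := by
    rcases v with ⟨α, a⟩ | ⟨b, β⟩
    · have h : ({g | Sum.inl (α, a) ∈ (expanderCode G).suppZ g} : Finset (B × A)) =
          leftNbr G α ×ˢ {a} := by
        ext ⟨x, y⟩
        simp [expanderCode, mem_leftNbr, mem_rightNbr, eq_comm]
      rw [h, card_product, card_singleton, hG.1 α]
      omega
    · have h : ({g | Sum.inr (b, β) ∈ (expanderCode G).suppZ g} : Finset (B × A)) =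
          {b} ×ˢ rightNbr G β := by
        ext ⟨x, y⟩
        simp [expanderCode, mem_leftNbr, mem_rightNbr, eq_comm]
      rw [h, card_product, card_singleton, hG.2 β]
      omega

/-- The dual code is the expander code of the graph with its two sides exchanged. -/
lemma hasFlips_expanderCode_dual {dA dB : ℕ} (hdA : 0 < dA) (hdB : 0 < dB) {γA δA γB δB : ℝ}
    (hδA : 0 < δA) (hδB : 0 < δB) (hexp : δA + δB + (δB - δA) ^ 2 < 1 / 4)
    (hG : IsBiregular G dA dB) (hA : IsLeftExpanding G dA γA δA)
    (hB : IsRightExpanding G dB γB δB) :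
    (expanderCode G).dual.HasFlips (min (γA * Fintype.card A) (γB * Fintype.card B)) := by
  let G' : B → A → Prop := fun b a => G a b
  let _ : DecidableRel G' := fun b a => inferInstanceAs (Decidable (G a b))
  have hl : ∀ b, leftNbr G' b = rightNbr G b := fun b => rfl
  have hr : ∀ a, rightNbr G' a = leftNbr G a := fun a => rfl
  have h : (expanderCode G').HasFlips (min (γB * Fintype.card B) (γA * Fintype.card A)) :=
    hasFlips_expanderCode hdB hdA hδB hδA (by linarith [sq_nonneg (δB - δA), sub_sq_comm δA δB])
      ⟨hG.2, hG.1⟩ hB hA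
  rw [min_comm]
  refine h.map (Equiv.sumComm _ _) ?_ ?_
  · rintro ⟨b, a⟩
    ext x
    rcases x with ⟨x, y⟩ | ⟨x, y⟩ <;>
      simp [CSSCode.dual, expanderCode, mem_leftNbr, mem_rightNbr, G']
  · rintro ⟨α, β⟩
    ext x
    rcases x with ⟨x, y⟩ | ⟨x, y⟩ <;>
      simp [CSSCode.dual, expanderCode, mem_leftNbr, mem_rightNbr, G']

end Expander

/-- The two sides of a biregular graph have sizes comparable to `√n`. -/
lemma sqrt_card_qubit_le {A : Type u} {B : Type v} [Fintype A] [Fintype B]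
    {G : A → B → Prop} [DecidableRel G] {dA dB : ℕ} (hdA : 0 < dA) (hdB : 0 < dB)
    (hG : IsBiregular G dA dB) :
    √(Fintype.card (Qubit A B) : ℝ) ≤ Fintype.card A * (1 + dA) ∧
      √(Fintype.card (Qubit A B) : ℝ) ≤ Fintype.card B * (1 + dB) := by
  have hedge : Fintype.card A * dA = Fintype.card B * dB := by
    have := sum_card_bipartiteAbove_eq_sum_card_bipartiteBelow (s := (univ : Finset A))
      (t := (univ : Finset B)) G
    change ∑ a, #(leftNbr G a) = ∑ b, #(rightNbr G b) at this
    simpa [hG.1, hG.2] using this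
  have hBA : Fintype.card B ≤ Fintype.card A * dA := hedge ▸ Nat.le_mul_of_pos_right _ hdB
  have hAB : Fintype.card A ≤ Fintype.card B * dB := hedge ▸ Nat.le_mul_of_pos_right _ hdA
  have hn : (Fintype.card (Qubit A B) : ℝ) =
      (Fintype.card A : ℝ) ^ 2 + (Fintype.card B : ℝ) ^ 2 := by
    simp [Qubit, sq]
  have key : ∀ x y d : ℝ, 0 ≤ x → 0 ≤ y → 0 ≤ d → y ≤ x * d → √(x ^ 2 + y ^ 2) ≤ x * (1 + d) := by
    intro x y d hx hy hd h
    rw [Real.sqrt_le_left (by positivity)]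
    nlinarith [mul_nonneg hx (mul_nonneg hx hd)]
  rw [hn]
  constructor
  · exact key _ _ _ (by positivity) (by positivity) (by positivity) (by exact_mod_cast hBA)
  · rw [add_comm]
    exact key _ _ _ (by positivity) (by positivity) (by positivity) (by exact_mod_cast hAB)

end QExpander

theorem theorem1
    (dA dB : ℕ) (hdA : 0 < dA) (hdB : 0 < dB)
    (γA δA γB δB : ℝ) (hγA : 0 < γA) (hδA : 0 < δA) (hγB : 0 < γB) (hδB : 0 < δB)
    (hexp : δA + δB + (δB - δA) ^ 2 < 1 / 4) :
    ∃ p₀ C C' : ℝ, 0 < p₀ ∧ p₀ ≤ 1 ∧ 0 < C ∧ 0 < C' ∧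
      ∀ (A : Type u) (B : Type v) [Fintype A] [Fintype B] [DecidableEq A] [DecidableEq B]
        (G : A → B → Prop) [DecidableRel G],
        IsBiregular G dA dB → IsLeftExpanding G dA γA δA → IsRightExpanding G dB γB δB →
        ∀ p : ℝ, 0 ≤ p → p < p₀ →
          (∀ D : PMF (Finset (Qubit A B)),
            (IsIndependentNoise D p ∨ IsLocalStochasticNoise D p) →
            1 - C * (Fintype.card (Qubit A B) : ℝ) *
                (p / p₀) ^ (C' * Real.sqrt (Fintype.card (Qubit A B) : ℝ))
              ≤ prob D {E | (expanderCode G).Corrects E}) ∧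
          (∀ D : PMF (Finset (Qubit A B) × Finset (Qubit A B)),
            (IsIndependentNoise (D.map Prod.fst) p ∨
              IsLocalStochasticNoise (D.map Prod.fst) p) →
            (IsIndependentNoise (D.map Prod.snd) p ∨
              IsLocalStochasticNoise (D.map Prod.snd) p) →
            1 - C * (Fintype.card (Qubit A B) : ℝ) *
                (p / p₀) ^ (C' * Real.sqrt (Fintype.card (Qubit A B) : ℝ))
              ≤ prob D {E | (expanderCode G).Corrects E.1 ∧
                  (expanderCode G).dual.Corrects E.2}) := by
  set w := dA + dB with hw
  have hw₀ : 0 < w := by omega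
  set M := 1 + w * w with hM
  have hM₀ : (0 : ℝ) < (M : ℕ) := by exact_mod_cast (by omega : 0 < M)
  set c : ℝ := min (γA / (1 + dA)) (γB / (1 + dB)) with hc
  have hc₀ : 0 < c := lt_min (by positivity) (by positivity)
  set q : ℝ := 1 / (4 * ((2 * w ^ 2 : ℕ) : ℝ) ^ 2) with hq
  have hq₀ : 0 < q := by positivity
  have hq₁ : q ≤ 1 := by
    have h : (1 : ℝ) ≤ ((2 * w ^ 2 : ℕ) : ℝ) ^ 2 :=
      one_le_pow₀ (by exact_mod_cast (by positivity : 0 < 2 * w ^ 2))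
    rw [hq, div_le_one (by positivity)]
    linarith
  -- The factor `2` pays for the union bound over the two types of errors.
  refine ⟨q ^ M, 2, c / M, by positivity, pow_le_one₀ hq₀.le hq₁, two_pos, by positivity, ?_⟩
  intro A B _ _ _ _ G _ hG hA hB p hp hp₀
  set n : ℝ := (Fintype.card (Qubit A B) : ℝ) with hn
  set x : ℝ := (p / q ^ M) ^ (c / M * √n) with hx
  have hx₀ : 0 ≤ x := Real.rpow_nonneg (by positivity) _
  have hn₀ : 0 ≤ n := Nat.cast_nonneg _
  have hexpo : c / M * √n = c * √n / (M : ℕ) := by ring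
  have hsqrt := sqrt_card_qubit_le hdA hdB hG
  have hct : c * √n ≤ min (γA * Fintype.card A) (γB * Fintype.card B) := by
    refine le_min ?_ ?_
    · calc c * √n ≤ γA / (1 + dA) * (Fintype.card A * (1 + dA)) :=
            mul_le_mul (min_le_left _ _) hsqrt.1 (Real.sqrt_nonneg _) (by positivity)
        _ = _ := by field_simp
    · calc c * √n ≤ γB / (1 + dB) * (Fintype.card B * (1 + dB)) :=
            mul_le_mul (min_le_right _ _) hsqrt.2 (Real.sqrt_nonneg _) (by positivity)
        _ = _ := by field_simp
  have hbdd := isBounded_expanderCode hG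
  have hXfail : ∀ D : PMF (Finset (Qubit A B)),
      (IsIndependentNoise D p ∨ IsLocalStochasticNoise D p) →
      prob D {E | ¬ (expanderCode G).Corrects E} ≤ n * x := by
    intro D hD
    rw [hx, hexpo]
    exact CSSCode.prob_not_corrects_le hw₀ hbdd (by positivity)
      ((hasFlips_expanderCode hdA hdB hδA hδB hexp hG hA hB).mono hct) hp hp₀ hD
  have hZfail : ∀ D : PMF (Finset (Qubit A B)),
      (IsIndependentNoise D p ∨ IsLocalStochasticNoise D p) →
      prob D {E | ¬ (expanderCode G).dual.Corrects E} ≤ n * x := by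
    intro D hD
    rw [hx, hexpo]
    exact CSSCode.prob_not_corrects_le hw₀ hbdd.dual (by positivity)
      ((hasFlips_expanderCode_dual hdA hdB hδA hδB hexp hG hA hB).mono hct) hp hp₀ hD
  have hnx : 0 ≤ n * x := mul_nonneg hn₀ hx₀
  constructor
  · intro D hD
    have h₁ : prob D {E | (expanderCode G).Corrects E} +
        prob D {E | ¬ (expanderCode G).Corrects E} = 1 := prob_add_prob_compl D _
    have h₂ := hXfail D hD
    linarith
  · intro D hD₁ hD₂
    have h₁ := prob_add_prob_compl D
      {E | (expanderCode G).Corrects E.1 ∧ (expanderCode G).dual.Corrects E.2}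
    have h₂ := hXfail _ hD₁
    have h₃ := hZfail _ hD₂
    rw [prob_map] at h₂ h₃
    have h₄ : prob D {E | (expanderCode G).Corrects E.1 ∧ (expanderCode G).dual.Corrects E.2}ᶜ ≤
        prob D (Prod.fst ⁻¹' {E | ¬ (expanderCode G).Corrects E}) +
          prob D (Prod.snd ⁻¹' {E | ¬ (expanderCode G).dual.Corrects E}) := by
      refine (prob_mono D fun E hE => ?_).trans (prob_union_le D _ _)
      exact not_and_or.1 hE
    linarith
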